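/- Let $n\in\mathbb N$. An $n$-dimensional charge is a $\sigma$-additive function $\mu=(\mu_1,\dots,\mu_n)$ from the Borel $\sigma$-algebra of $\mathbb R^n$ to $\mathbb R^n$. It acts on bounded measurable vector fields $\varphi=(\varphi_1,\dots,\varphi_n):\mathbb R^n\to\mathbb R^n$ by $\langle\mu,\varphi\rangle=\sum_{k=1}^n\int\varphi_k\,d\mu_k$. Its variation measure is the finite positive Borel measure $\|\mu\|(E)=\sup\{\sum_{k}|\mu(E_k)| : E_k\subseteq E \text{ pairwise disjoint Borel sets}\}$, where $|\cdot|$ is the Euclidean norm; $\operatorname{Var}(\mu)=\|\mu\|(\mathbb R^n)$, $\operatorname{supp}(\mu)$ is the support of $\|\mu\|$, and $\operatorname{Div}(\mu)$ is the distribution $\langle\operatorname{Div}(\mu),\psi\rangle=-\langle\mu,\nabla\psi\rangle$ for $\psi\in C_c^\infty(\mathbb R^n)$. For $\ell>0$ let $K_\ell$ be the set of all $1$-Lipschitz curves $\gamma:[0,\ell]\to\mathbb R^n$ (Euclidean norm), with the topology of uniform convergence and its Borel $\sigma$-algebra. For $\gamma\in K_\ell$ let $[\gamma]$ be the charge $[\gamma](A)=\int_{\{t\in[0,\ell]\,:\,\gamma(t)\in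 A\}}\dot\gamma(t)\,dt$, so that $\langle[\gamma],\varphi\rangle=\int_0^\ell\langle\varphi(\gamma(t)),\dot\gamma(t)\rangle\,dt$, and let $L(\gamma)=\int_0^\ell|\dot\gamma(t)|\,dt$ be the length of $\gamma$. **Theorem.** For every $\ell>0$ and every $n$-dimensional charge $\mu$ with $\operatorname{Div}(\mu)=0$ there is a finite positive Borel measure $\nu$ on $K_\ell$ such that $$\mu=\int_{K_\ell}[\gamma]\,d\nu(\gamma)\qquad\text{and}\qquad \|\mu\|=\int_{K_\ell}\|[\gamma]\|\,d\nu(\gamma),$$ and such that $\nu$-almost every $\gamma\in K_\ell$ takes all its values in $\operatorname{supp}(\mu)$ and satisfies $\operatorname{Var}([\gamma])=L(\gamma)=\ell$. Here the first identity means that for every continuous vector field $\varphi:\mathbb R^n\to\mathbb R^n$ with compact support the function $\gamma\mapsto\langle[\gamma],\varphi\rangle$ is $\nu$-integrable and $\langle\mu,\varphi\rangle=\int_{K_\ell}\langle[\gamma],\varphi\rangle\,d\nu(\gamma)$; the second means that for every Borel set $A\subseteq\mathbb R^n$ the function $\gamma\mapsto\|[\gamma]\|(A)$ is $\nu$-measurable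 and $\|\mu\|(A)=\int_{K_\ell}\|[\gamma]\|(A)\,d\nu(\gamma)$. -/

import Mathlib

open MeasureTheory Set
open scoped ENNReal Distributions Gradient

noncomputable section

namespace Smirnov

/-- The Euclidean space `ℝⁿ`, with the Euclidean norm and its Borel σ-algebra. -/
abbrev Rn (n : ℕ) : Type := EuclideanSpace ℝ (Fin n)

/-- An `n`-dimensional charge: a σ-additive function from the Borel σ-algebra of `ℝⁿ` to `ℝⁿ`. Its
variation measure is `VectorMeasure.variation`. -/
abbrev Charge (n : ℕ) : Type := VectorMeasure (Rn n) (Rn n)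

variable {n : ℕ} {ℓ : ℝ}

/-- The variation measure of a charge is finite, so that bounded measurable fields are integrable
against it and the action below is never a junk value for them. -/
theorem Charge.isFiniteMeasure_variation (μ : Charge n) :
    IsFiniteMeasure (VectorMeasure.variation μ) := by
  let s : Fin n → SignedMeasure (Rn n) := fun k =>
    μ.mapRange (EuclideanSpace.proj (𝕜 := ℝ) k : Rn n →L[ℝ] ℝ).toLinearMap.toAddMonoidHom
      (EuclideanSpace.proj (𝕜 := ℝ) k : Rn n →L[ℝ] ℝ).continuous
  refine @isFiniteMeasure_of_le _ _ _ (∑ k, (s k).variation) ?_ ?_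
  · refine ⟨?_⟩
    simp only [Measure.coe_finsetSum, Finset.sum_apply]
    refine ENNReal.sum_lt_top.2 fun k _ => ?_
    rw [← SignedMeasure.totalVariation_eq_variation, SignedMeasure.totalVariation]
    exact measure_lt_top _ _
  · refine VectorMeasure.variation_le_of_forall_enorm_le fun E hE => ?_
    simp only [Measure.coe_finsetSum, Finset.sum_apply]
    refine le_trans ?_ (Finset.sum_le_sum fun k _ => (s k).enorm_measure_le_variation E)
    have : ‖μ E‖ₑ ≤ ∑ k, ‖(μ E) k‖ₑ := by
      conv_lhs => rw [← (EuclideanSpace.basisFun (Fin n) ℝ).sum_repr (μ E)]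
      refine (enorm_sum_le _ _).trans (Finset.sum_le_sum fun k _ => ?_)
      rw [enorm_smul]
      simp [enorm_eq_nnnorm]
    exact this

/-- The action `⟨μ, φ⟩ = ∑ₖ ∫ φₖ dμₖ` of a charge on a vector field: the integral of `φ` against
the vector measure `μ` with respect to the Euclidean inner product. -/
def Charge.pairing (μ : Charge n) (φ : Rn n → Rn n) : ℝ :=
  VectorMeasure.integral μ φ (innerSL ℝ)

/-- The distributional divergence of a charge, a functional on the test functions on `ℝⁿ`:
`⟨Div μ, ψ⟩ = -⟨μ, ∇ψ⟩`. -/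
def Charge.div (μ : Charge n) : 𝓓((⊤ : TopologicalSpace.Opens (Rn n)), ℝ) → ℝ :=
  fun ψ => -Charge.pairing μ (∇ ψ)

/-- The total variation of a charge. -/
def Charge.totalVar (μ : Charge n) : ℝ≥0∞ := VectorMeasure.variation μ univ

/-- The support of a charge: the points all of whose neighbourhoods have positive variation. -/
def Charge.supp (μ : Charge n) : Set (Rn n) := (VectorMeasure.variation μ).support

/-- `C([0,ℓ], ℝⁿ)` carries the Borel σ-algebra of the topology of uniform convergence. -/
instance : MeasurableSpace C(Icc (0 : ℝ) ℓ, Rn n) := borel _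

instance : BorelSpace C(Icc (0 : ℝ) ℓ, Rn n) := ⟨rfl⟩

variable (n ℓ) in
/-- The space `K_ℓ` of `1`-Lipschitz curves `[0,ℓ] → ℝⁿ`, as a subspace of `C([0,ℓ], ℝⁿ)`. -/
abbrev Curve : Type := {γ : C(Icc (0 : ℝ) ℓ, Rn n) // LipschitzWith 1 γ}

variable (ℓ) in
/-- Lebesgue measure on the interval `[0,ℓ]`. -/
def lebesgue : Measure (Icc (0 : ℝ) ℓ) := (volume : Measure ℝ).comap Subtype.val

/-- The derivative of a curve. The curve is extended by `0` to the real line, which does not affect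
the derivative on the open interval `(0,ℓ)`. -/
def Curve.velocity (γ : Curve n ℓ) (t : Icc (0 : ℝ) ℓ) : Rn n :=
  deriv (Function.extend Subtype.val γ.1 0) (t : ℝ)

theorem Curve.integrable_velocity (γ : Curve n ℓ) : Integrable γ.velocity (lebesgue ℓ) := by
  have hsub := MeasurableEmbedding.subtype_coe (measurableSet_Icc (a := (0 : ℝ)) (b := ℓ))
  have hfin : IsFiniteMeasure (lebesgue ℓ) := by
    refine ⟨?_⟩
    rw [lebesgue, hsub.comap_apply]
    refine (measure_mono (t := Icc 0 ℓ) ?_).trans_lt (by simp)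
    rintro _ ⟨x, _, rfl⟩
    exact x.2
  have hI : ∀ᵐ t ∂lebesgue ℓ, t.1 ∈ Ioo 0 ℓ := by
    rw [ae_iff, lebesgue, hsub.comap_apply]
    refine measure_mono_null (t := {0, ℓ}) ?_ ((Set.toFinite _).measure_zero _)
    rintro _ ⟨x, hx, rfl⟩
    have h1 := x.2.1
    have h2 := x.2.2
    simp only [mem_ofPred_eq, mem_Ioo, not_and_or, not_lt] at hx
    rcases hx with h | h
    · exact Or.inl (le_antisymm h h1)
    · exact Or.inr (le_antisymm h2 h)
  refine Integrable.of_bound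
    ((measurable_deriv _).comp measurable_subtype_coe).aestronglyMeasurable 1 ?_
  filter_upwards [hI] with t ht
  have hval : ∀ t : Icc 0 ℓ, Function.extend Subtype.val γ.1 0 t.1 = γ.1 t := fun t =>
    Subtype.val_injective.extend_apply _ _ _
  have := norm_deriv_le_of_lipschitzOn (f := Function.extend Subtype.val γ.1 0) (x₀ := t.1)
    (s := Icc 0 ℓ) (C := 1) (Icc_mem_nhds ht.1 ht.2) (by
      intro x hx y hy
      simpa only [hval ⟨x, hx⟩, hval ⟨y, hy⟩] using! γ.2 ⟨x, hx⟩ ⟨y, hy⟩)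
  simpa using! this

/-- The charge `[γ]` of a curve: the push-forward under `γ` of the vector measure `γ̇ · λ¹` on
`[0,ℓ]`, i.e. `[γ](A) = ∫_{γ ∈ A} γ̇ dλ¹`. -/
def Curve.charge (γ : Curve n ℓ) : Charge n :=
  ((lebesgue ℓ).withDensityᵥ γ.velocity).map γ.1

theorem Curve.charge_apply (γ : Curve n ℓ) {A : Set (Rn n)} (hA : MeasurableSet A) :
    γ.charge A = ∫ t in γ.1 ⁻¹' A, γ.velocity t ∂lebesgue ℓ := by
  have hm : Measurable γ.1 := γ.1.continuous.measurable
  rw [Curve.charge, VectorMeasure.map_apply _ hm hA,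
    withDensityᵥ_apply γ.integrable_velocity (hm hA)]

/-- The length `L(γ) = ∫_{[0,ℓ]} |γ̇| dλ¹` of a curve. -/
def Curve.length (γ : Curve n ℓ) : ℝ≥0∞ := ∫⁻ t, ‖γ.velocity t‖ₑ ∂lebesgue ℓ

/-- `μ = ∫ [γ] dν(γ)` in the weak sense: `⟨μ, φ⟩ = ∫ ⟨[γ], φ⟩ dν(γ)` for all continuous
vector fields `φ` with compact support. -/
def IsDecomposition (μ : Charge n) (ν : Measure (Curve n ℓ)) : Prop :=
  ∀ φ : Rn n → Rn n, Continuous φ → HasCompactSupport φ →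
    Integrable (fun γ : Curve n ℓ => γ.charge.pairing φ) ν ∧
      μ.pairing φ = ∫ γ : Curve n ℓ, γ.charge.pairing φ ∂ν

/-- `‖μ‖ = ∫ ‖[γ]‖ dν(γ)` as an identity of positive Borel measures. -/
def VariationDecomposes (μ : Charge n) (ν : Measure (Curve n ℓ)) : Prop :=
  ∀ A : Set (Rn n), MeasurableSet A →
    AEMeasurable (fun γ : Curve n ℓ => VectorMeasure.variation γ.charge A) ν ∧
      VectorMeasure.variation μ A = ∫⁻ γ : Curve n ℓ, VectorMeasure.variation γ.charge A ∂ν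

end Smirnov

end

/-!
The measure `ν` comes from Hahn–Banach and Riesz, once it is known that a field `φ` with
`⟨[γ], φ⟩ ≤ S` for all `γ ∈ K_ℓ` satisfies `ℓ ⟨μ, φ⟩ ≤ S Var(μ)`. To see this, let `h = ℓ / N` and
let `V_k(x)` be the largest Riemann sum of `φ` over the paths of `k` steps of length at most `h`
from `x`. Bellman's inequality `⟨φ(x), w⟩ + V_k(x + w) ≤ V_{k+1}(x)`, for `|w| ≤ h`, shows that
`h |φ + ∇V_k| ≤ V_{k+1} - V_k + o(h)` after mollification. As `Div μ = 0`, the field `φ` may be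
replaced by `φ + ∇V_k`, so that `h ⟨μ, φ⟩ ≤ ∫ (V_{k+1} - V_k) d‖μ‖ + o(h)`. The sum over `k < N`
telescopes to `∫ V_N d‖μ‖`, and `V_N ≤ S + o(1)` because a path of `N` steps is interpolated by a
curve of `K_ℓ`.

This gives `ℓ ν(K_ℓ) ≤ Var(μ)`, while `Var([γ]) ≤ L(γ) ≤ ℓ` for every curve. Hence equality holds
throughout `Var(μ) ≤ ∫ Var([γ]) dν(γ) ≤ ℓ ν(K_ℓ) ≤ Var(μ)`, from which the remaining claims follow.
-/

noncomputable section

namespace Smirnov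

section Approximation

open NormedSpace

variable {X V : Type*} [NormedAddCommGroup V]

theorem norm_sum_indicator_le {P : Finset (Set X)}
    (hP : (P : Set (Set X)).PairwiseDisjoint id) {v : Set X → V} {C : ℝ}
    (hv : ∀ A, ‖v A‖ ≤ C) (x : X) : ‖∑ A ∈ P, A.indicator (fun _ => v A) x‖ ≤ C := by
  by_cases hx : ∃ A ∈ P, x ∈ A
  · obtain ⟨A, hA, hxA⟩ := hx
    have hzero : ∀ B ∈ P, B ≠ A → B.indicator (fun _ => v B) x = 0 := fun B hB hBA =>
      indicator_of_notMem (fun hxB => disjoint_left.1 (hP hB hA hBA) hxB hxA) _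
    rw [Finset.sum_eq_single_of_mem A hA hzero, indicator_of_mem hxA]
    exact hv A
  · push Not at hx
    rw [Finset.sum_eq_zero fun A hA => indicator_of_notMem (hx A hA) _, norm_zero]
    exact (norm_nonneg _).trans (hv ∅)

variable [NormedSpace ℝ V]

theorem norm_normalize_le_one (v : V) : ‖normalize v‖ ≤ 1 := by
  rcases eq_or_ne v 0 with rfl | hv
  · simp
  · exact (norm_normalize_eq_one_iff.2 hv).le

/-- The radial retraction of a normed space onto its closed unit ball. It truncates approximating
fields to norm at most `1`. -/
def unitBallRetraction (v : V) : V := (max 1 ‖v‖)⁻¹ • v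

theorem continuous_unitBallRetraction : Continuous (unitBallRetraction (V := V)) :=
  (continuous_const.max continuous_norm).inv₀ (fun _ => by positivity) |>.smul continuous_id

theorem unitBallRetraction_zero : unitBallRetraction (0 : V) = 0 := smul_zero _

theorem norm_unitBallRetraction_le (v : V) : ‖unitBallRetraction v‖ ≤ 1 := by
  rw [unitBallRetraction, norm_smul, norm_inv, Real.norm_of_nonneg (by positivity),
    inv_mul_le_iff₀ (by positivity), mul_one]
  exact le_max_right _ _

theorem norm_sub_unitBallRetraction_le {v w : V} (hw : ‖w‖ ≤ 1) :
    ‖v - unitBallRetraction v‖ ≤ ‖w - v‖ := by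
  rcases le_total ‖v‖ 1 with hv | hv
  · simp [unitBallRetraction, max_eq_left hv]
  · calc ‖v - unitBallRetraction v‖ = ‖(1 - ‖v‖⁻¹) • v‖ := by
          rw [unitBallRetraction, max_eq_right hv, sub_smul, one_smul]
      _ = ‖v‖ - 1 := by
          rw [norm_smul, Real.norm_of_nonneg (sub_nonneg.2 (inv_le_one_of_one_le₀ hv)), sub_mul,
            inv_mul_cancel₀ (by positivity), one_mul]
      _ ≤ ‖v‖ - ‖w‖ := by gcongr
      _ ≤ ‖w - v‖ := norm_sub_rev w v ▸ norm_sub_norm_le v w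

theorem exists_continuous_norm_le_one_integral_sub_le [TopologicalSpace X] [NormalSpace X]
    [R1Space X] [WeaklyLocallyCompactSpace X] [MeasurableSpace X] [BorelSpace X] {η : Measure X}
    [η.Regular] {ψ : X → V} (hψ : Integrable ψ η) (hψ1 : ∀ x, ‖ψ x‖ ≤ 1) {ε : ℝ} (hε : 0 < ε) :
    ∃ φ : X → V, Continuous φ ∧ HasCompactSupport φ ∧ (∀ x, ‖φ x‖ ≤ 1) ∧
      ∫ x, ‖ψ x - φ x‖ ∂η ≤ ε := by
  obtain ⟨g, hgs, hgε, hgc, hgi⟩ := hψ.exists_hasCompactSupport_integral_sub_le (half_pos hε)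
  have hφc : Continuous fun x => unitBallRetraction (g x) := continuous_unitBallRetraction.comp hgc
  have hφs : HasCompactSupport fun x => unitBallRetraction (g x) :=
    hgs.comp_left (g := unitBallRetraction) unitBallRetraction_zero
  refine ⟨_, hφc, hφs, fun x => norm_unitBallRetraction_le _, ?_⟩
  calc ∫ x, ‖ψ x - unitBallRetraction (g x)‖ ∂η ≤ ∫ x, 2 * ‖ψ x - g x‖ ∂η := by
        refine integral_mono (hψ.sub (hφc.integrable_of_hasCompactSupport hφs)).norm
          ((hψ.sub hgi).norm.const_mul 2) fun x => ?_
        linarith [norm_sub_unitBallRetraction_le (v := g x) (hψ1 x),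
          norm_sub_le_norm_sub_add_norm_sub (ψ x) (g x) (unitBallRetraction (g x))]
    _ ≤ ε := by rw [integral_const_mul]; linarith

end Approximation

section VectorMeasure

open NormedSpace

variable {X E : Type*} [MeasurableSpace X] [NormedAddCommGroup E] [InnerProductSpace ℝ E]
  {μ : VectorMeasure X E}

theorem abs_integral_inner_le (φ : X → E) :
    |μ.integral φ (innerSL ℝ)| ≤ ∫ x, ‖φ x‖ ∂μ.variation :=
  VectorMeasure.norm_integral_le_integral_norm.trans <|
    mul_le_of_le_one_left (integral_nonneg fun _ => norm_nonneg _) (norm_innerSL_le ℝ)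

theorem abs_integral_inner_sub_le {φ ψ : X → E} (hφ : μ.Integrable φ) (hψ : μ.Integrable ψ) :
    |μ.integral φ (innerSL ℝ) - μ.integral ψ (innerSL ℝ)| ≤ ∫ x, ‖φ x - ψ x‖ ∂μ.variation := by
  rw [← VectorMeasure.integral_fun_sub hφ hψ]
  exact abs_integral_inner_le _

theorem inner_normalize_self (v : E) : inner ℝ (normalize v) v = ‖v‖ := by
  rw [NormedSpace.normalize, real_inner_smul_left, real_inner_self_eq_norm_mul_norm, ← mul_assoc,
    inv_mul_mul_self]

theorem integral_indicator_normalize [IsFiniteMeasure μ.variation] {A : Set X}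
    (hA : MeasurableSet A) :
    μ.integral (A.indicator fun _ => normalize (μ A)) (innerSL ℝ) = ‖μ A‖ := by
  rw [VectorMeasure.integral_indicator_const _ hA, innerSL_apply_apply, inner_normalize_self]

theorem exists_step_integral_inner_gt [IsFiniteMeasure μ.variation] {c : ℝ≥0∞}
    (hc : c < μ.variation univ) :
    ∃ ψ : X → E, μ.Integrable ψ ∧ (∀ x, ‖ψ x‖ ≤ 1) ∧
      c.toReal < μ.integral ψ (innerSL ℝ) := by
  obtain ⟨P, -, hPd, hPm, hPc⟩ := μ.exists_lt_sum_of_lt_variation MeasurableSet.univ hc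
  have hint : ∀ A ∈ P, μ.Integrable (A.indicator fun _ => normalize (μ A)) := fun A hA =>
    (integrable_const _).indicator (hPm A hA)
  refine ⟨fun x => ∑ A ∈ P, A.indicator (fun _ => normalize (μ A)) x,
    VectorMeasure.Integrable.fun_finsetSum P hint,
    norm_sum_indicator_le hPd fun A => norm_normalize_le_one (μ A), ?_⟩
  rw [VectorMeasure.integral_finsetSum P hint,
    Finset.sum_congr rfl fun A hA => integral_indicator_normalize (hPm A hA),
    ← ENNReal.lt_ofReal_iff_toReal_lt hc.ne_top,
    ENNReal.ofReal_sum_of_nonneg fun _ _ => norm_nonneg _]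
  simpa only [ofReal_norm] using hPc

variable [TopologicalSpace X] [NormalSpace X] [R1Space X] [WeaklyLocallyCompactSpace X]
  [BorelSpace X]

theorem exists_continuous_integral_inner_gt [IsFiniteMeasure μ.variation] [μ.variation.Regular]
    {c : ℝ≥0∞} (hc : c < μ.variation univ) :
    ∃ φ : X → E, Continuous φ ∧ HasCompactSupport φ ∧ (∀ x, ‖φ x‖ ≤ 1) ∧
      c.toReal < μ.integral φ (innerSL ℝ) := by
  obtain ⟨ψ, hψ, hψ1, hcψ⟩ := exists_step_integral_inner_gt hc
  obtain ⟨φ, hφc, hφs, hφ1, hφψ⟩ := exists_continuous_norm_le_one_integral_sub_le hψ hψ1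
    (half_pos (sub_pos.2 hcψ))
  refine ⟨φ, hφc, hφs, hφ1, ?_⟩
  have hclose := (abs_integral_inner_sub_le hψ
    (hφc.integrable_of_hasCompactSupport hφs)).trans hφψ
  linarith [(abs_le.1 hclose).2]

theorem abs_integral_inner_le_of_forall_continuous {η : Measure X} [(μ.variation + η).Regular]
    (h : ∀ φ : X → E, Continuous φ → HasCompactSupport φ →
      |μ.integral φ (innerSL ℝ)| ≤ ∫ x, ‖φ x‖ ∂η)
    {ψ : X → E} (hψ : Integrable ψ (μ.variation + η)) :
    |μ.integral ψ (innerSL ℝ)| ≤ ∫ x, ‖ψ x‖ ∂η := by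
  refine le_of_forall_pos_le_add fun ε hε => ?_
  obtain ⟨φ, hφs, hφε, hφc, hφ⟩ := hψ.exists_hasCompactSupport_integral_sub_le hε
  have hψμ := hψ.left_of_add_measure
  have hψη := hψ.right_of_add_measure
  have hφμ := hφ.left_of_add_measure
  have hφη := hφ.right_of_add_measure
  have hclose : ∫ x, ‖ψ x - φ x‖ ∂μ.variation + ∫ x, ‖ψ x - φ x‖ ∂η ≤ ε :=
    (integral_add_measure (hψμ.sub hφμ).norm (hψη.sub hφη).norm).symm.trans_le hφε
  have hnorm : ∫ x, ‖φ x‖ ∂η ≤ ∫ x, ‖ψ x‖ ∂η + ∫ x, ‖ψ x - φ x‖ ∂η := by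
    have hdiff : Integrable (fun x => ‖ψ x - φ x‖) η := (hψη.sub hφη).norm
    rw [← integral_add hψη.norm hdiff]
    exact integral_mono hφη.norm (hψη.norm.add hdiff) fun x =>
      norm_le_norm_add_norm_sub (ψ x) (φ x)
  linarith [abs_sub_abs_le_abs_sub (μ.integral ψ (innerSL ℝ)) (μ.integral φ (innerSL ℝ)),
    abs_integral_inner_sub_le hψμ hφμ, h φ hφc hφs]

theorem variation_le_of_abs_integral_inner_le [IsFiniteMeasure μ.variation] {η : Measure X}
    [IsFiniteMeasure η] [(μ.variation + η).Regular]
    (h : ∀ φ : X → E, Continuous φ → HasCompactSupport φ →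
      |μ.integral φ (innerSL ℝ)| ≤ ∫ x, ‖φ x‖ ∂η) :
    μ.variation ≤ η := by
  refine VectorMeasure.variation_le_of_forall_enorm_le fun A hA => ?_
  rw [← ofReal_norm, ENNReal.ofReal_le_iff_le_toReal (measure_ne_top _ _)]
  have hint : Integrable (A.indicator fun _ => normalize (μ A)) (μ.variation + η) :=
    (integrable_const _).indicator hA
  calc ‖μ A‖ = |μ.integral (A.indicator fun _ => normalize (μ A)) (innerSL ℝ)| := by
        rw [integral_indicator_normalize hA, abs_norm]
    _ ≤ ∫ x, ‖A.indicator (fun _ => normalize (μ A)) x‖ ∂η :=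
        abs_integral_inner_le_of_forall_continuous h hint
    _ = ∫ _ in A, ‖normalize (μ A)‖ ∂η := by
        simp only [norm_indicator_eq_indicator_norm, integral_indicator hA]
    _ = η.real A * ‖normalize (μ A)‖ := by rw [setIntegral_const, smul_eq_mul]
    _ ≤ η.real A := mul_le_of_le_one_right measureReal_nonneg (norm_normalize_le_one _)

end VectorMeasure

section WithDensity

open NormedSpace

variable {X E F G : Type*} [MeasurableSpace X] [NormedAddCommGroup E] [NormedAddCommGroup F]
  [NormedAddCommGroup G] {ν : Measure X} {f : X → F} {φ ψ : X → E}

theorem integral_norm_withDensity_enorm (hf : AEStronglyMeasurable f ν) (φ : X → E) :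
    ∫ x, ‖φ x‖ ∂(ν.withDensity fun x => ‖f x‖ₑ) = ∫ x, ‖f x‖ * ‖φ x‖ ∂ν :=
  integral_withDensity_eq_integral_smul₀ hf.nnnorm.aemeasurable (fun x => ‖φ x‖)

variable [NormedSpace ℝ E]

theorem integrable_norm_smul_of_withDensity_enorm (hf : AEStronglyMeasurable f ν)
    (hφ : Integrable φ (ν.withDensity fun x => ‖f x‖ₑ)) :
    Integrable (fun x => ‖f x‖ • φ x) ν :=
  (integrable_withDensity_iff_integrable_smul₀ hf.nnnorm.aemeasurable).1 hφ

variable [NormedSpace ℝ F] [NormedSpace ℝ G] (B : E →L[ℝ] F →L[ℝ] G)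

-- The field `φ` need only be measurable off the zeros of `f`, so the norm of `f` is moved onto it.
theorem integrable_bilin_of_withDensity_enorm (hf : AEStronglyMeasurable f ν)
    (hφ : Integrable φ (ν.withDensity fun x => ‖f x‖ₑ)) :
    Integrable (fun x => B (φ x) (f x)) ν := by
  have hnorm : AEStronglyMeasurable (fun x => normalize (f x)) ν :=
    hf.norm.aemeasurable.inv.aestronglyMeasurable.smul hf
  have hB : ∀ x, B (‖f x‖ • φ x) (normalize (f x)) = B (φ x) (f x) := fun x => by
    rw [map_smul, smul_apply, ← map_smul, norm_smul_normalize]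
  simpa only [hB] using B.integrable_of_bilin_of_bdd_right 1
    (integrable_norm_smul_of_withDensity_enorm hf hφ) hnorm
    (Filter.Eventually.of_forall fun x => norm_normalize_le_one (f x))

theorem norm_integral_bilin_sub_le (hf : AEStronglyMeasurable f ν)
    (hφ : Integrable φ (ν.withDensity fun x => ‖f x‖ₑ))
    (hψ : Integrable ψ (ν.withDensity fun x => ‖f x‖ₑ)) :
    ‖(∫ x, B (φ x) (f x) ∂ν) - ∫ x, B (ψ x) (f x) ∂ν‖ ≤
      ‖B‖ * ∫ x, ‖φ x - ψ x‖ ∂(ν.withDensity fun x => ‖f x‖ₑ) := by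
  rw [← integral_sub (integrable_bilin_of_withDensity_enorm B hf hφ)
    (integrable_bilin_of_withDensity_enorm B hf hψ), integral_norm_withDensity_enorm hf,
    ← integral_const_mul]
  have hint : Integrable (fun x => ‖f x‖ * ‖φ x - ψ x‖) ν :=
    (integrable_norm_smul_of_withDensity_enorm hf (hφ.sub hψ)).norm.congr <|
      Filter.Eventually.of_forall fun x => by simp [norm_smul]
  refine norm_integral_le_of_norm_le (hint.const_mul _) (Filter.Eventually.of_forall fun x => ?_)
  calc ‖B (φ x) (f x) - B (ψ x) (f x)‖ = ‖B (φ x - ψ x) (f x)‖ := by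
        rw [map_sub, sub_apply]
    _ ≤ ‖B‖ * ‖φ x - ψ x‖ * ‖f x‖ := B.le_opNorm₂ _ _
    _ = ‖B‖ * (‖f x‖ * ‖φ x - ψ x‖) := by ring

theorem continuous_integral_bilin (hf : AEStronglyMeasurable f ν) :
    Continuous fun φ : X →₁[ν.withDensity fun x => ‖f x‖ₑ] E => ∫ x, B (φ x) (f x) ∂ν := by
  refine (LipschitzWith.of_dist_le_mul (K := ‖B‖₊) fun φ ψ => ?_).continuous
  rw [dist_eq_norm, L1.dist_eq_integral_dist]
  simpa only [dist_eq_norm, coe_nnnorm] using norm_integral_bilin_sub_le B hf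
    (L1.integrable_coeFn φ) (L1.integrable_coeFn ψ)

theorem integral_withDensityᵥ [CompleteSpace F] [CompleteSpace G] (hf : Integrable f ν)
    (hφ : (ν.withDensityᵥ f).Integrable φ) :
    (ν.withDensityᵥ f).integral φ B = ∫ x, B (φ x) (f x) ∂ν := by
  have hvar := Measure.variation_withDensityᵥ hf
  refine Integrable.induction (μ := (ν.withDensityᵥ f).variation)
    (fun φ => (ν.withDensityᵥ f).integral φ B = ∫ x, B (φ x) (f x) ∂ν) ?_ ?_ ?_ ?_ hφ
  · intro c A hA hcA
    have : IsFiniteMeasure ((ν.withDensityᵥ f).variation.restrict A) := ⟨by simpa using hcA⟩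
    have hB : ∀ x, B (A.indicator (fun _ => c) x) (f x) = A.indicator (fun x => B c (f x)) x :=
      fun x => by by_cases hx : x ∈ A <;> simp [hx]
    simp only [VectorMeasure.integral_indicator_const _ hA, withDensityᵥ_apply hf hA, hB,
      integral_indicator hA, (B c).integral_comp_comm hf.integrableOn]
  · intro φ ψ _ hφ hψ hφB hψB
    rw [VectorMeasure.integral_add hφ hψ, hφB, hψB]
    rw [hvar] at hφ hψ
    rw [← integral_add (integrable_bilin_of_withDensity_enorm B hf.1 hφ)
      (integrable_bilin_of_withDensity_enorm B hf.1 hψ)]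
    simp only [Pi.add_apply, map_add, add_apply]
  · refine isClosed_eq VectorMeasure.continuous_integral ?_
    rw [hvar]
    exact continuous_integral_bilin B hf.1
  · intro φ ψ hφψ hφ hφB
    rw [← VectorMeasure.integral_congr_ae hφψ, hφB]
    have hzero : ∫ x, ‖φ x - ψ x‖ ∂(ν.withDensityᵥ f).variation = 0 :=
      integral_eq_zero_of_ae <| hφψ.mono fun x hx => by simp [hx]
    have hψ := hφ.congr hφψ
    rw [hvar] at hzero hφ hψ
    have hdist := norm_integral_bilin_sub_le B hf.1 hφ hψ
    rwa [hzero, mul_zero, norm_le_zero_iff, sub_eq_zero] at hdist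

end WithDensity

section LipschitzPath

variable {E : Type*} [NormedAddCommGroup E] {K : NNReal} {f : ℝ → E}

theorem intervalIntegrable_deriv_of_lipschitzWith [NormedSpace ℝ E] [CompleteSpace E]
    (hf : LipschitzWith K f) (a b : ℝ) : IntervalIntegrable (deriv f) volume a b :=
  (intervalIntegrable_const (c := (K : ℝ))).mono_fun (aestronglyMeasurable_deriv _ _) <|
    Filter.Eventually.of_forall fun _ => by simpa using norm_deriv_le_of_lipschitz hf

theorem integral_deriv_eq_sub_of_lipschitzWith [NormedSpace ℝ E] [FiniteDimensional ℝ E]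
    (hf : LipschitzWith K f) (a b : ℝ) : ∫ t in a..b, deriv f t = f b - f a := by
  have := FiniteDimensional.complete ℝ E
  refine (SeparatingDual.eq_iff_forall_dual_eq (R := ℝ)).2 fun g => ?_
  have hg : LipschitzWith (‖g‖₊ * K) (g ∘ f) := g.lipschitz.comp hf
  have hderiv : ∀ᵐ t : ℝ, t ∈ uIoc a b → g (deriv f t) = deriv (g ∘ f) t := by
    filter_upwards [hf.ae_differentiableAt] with t ht _
    exact (g.hasFDerivAt.comp_hasDerivAt t ht.hasDerivAt).deriv.symm
  rw [← g.intervalIntegral_comp_comm (intervalIntegrable_deriv_of_lipschitzWith hf a b),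
    intervalIntegral.integral_congr_ae hderiv,
    hg.lipschitzOnWith.absolutelyContinuousOnInterval.integral_deriv_eq_sub, map_sub,
    Function.comp_apply, Function.comp_apply]

theorem integral_comp_floor_div [NormedSpace ℝ E] [CompleteSpace E] {h : ℝ} (hh : 0 < h)
    (u : ℕ → E) (j : ℕ) :
    ∫ s in (j * h)..((j + 1 : ℕ) * h), u ⌊s / h⌋₊ = h • u j := by
  have hle : j * h ≤ (j + 1 : ℕ) * h := by gcongr; exact j.le_succ
  have hconst : (Ioo (j * h) ((j + 1 : ℕ) * h)).EqOn (fun s => u ⌊s / h⌋₊) fun _ => u j := by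
    refine fun s hs => congrArg u ?_
    have hj : (j : ℝ) ≤ s / h := (le_div_iff₀ hh).2 hs.1.le
    refine (Nat.floor_eq_iff (j.cast_nonneg.trans hj)).2 ⟨hj, (div_lt_iff₀ hh).2 ?_⟩
    exact_mod_cast hs.2
  rw [intervalIntegral.integral_congr_Ioo_of_le hle hconst, intervalIntegral.integral_const,
    ← sub_mul, Nat.cast_succ, add_sub_cancel_left, one_mul]

theorem exists_lipschitzWith_one_interpolating [NormedSpace ℝ E] [CompleteSpace E] {h : ℝ}
    (hh : 0 < h) {p : ℕ → E} (hp : ∀ j, dist (p j) (p (j + 1)) ≤ h) :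
    ∃ f : ℝ → E, LipschitzWith 1 f ∧ ∀ j : ℕ, f (j * h) = p j := by
  let u : ℕ → E := fun j => h⁻¹ • (p (j + 1) - p j)
  let g : ℝ → E := fun s => u ⌊s / h⌋₊
  have hu : ∀ j, ‖u j‖ ≤ 1 := fun j => by
    rw [norm_smul, norm_inv, Real.norm_of_nonneg hh.le, ← dist_eq_norm', inv_mul_le_one₀ hh]
    exact hp j
  have hg : ∀ a b, IntervalIntegrable g volume a b := fun a b =>
    (intervalIntegrable_const (c := (1 : ℝ))).mono_fun
      ((StronglyMeasurable.of_discrete (f := u)).comp_measurable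
        (Nat.measurable_floor.comp (measurable_id.div_const h))).aestronglyMeasurable <|
      Filter.Eventually.of_forall fun s => by simpa using hu _
  refine ⟨fun t => p 0 + ∫ s in (0 : ℝ)..t, g s, LipschitzWith.of_dist_le_mul fun s t => ?_,
    fun j => ?_⟩
  · rw [dist_add_left, dist_eq_norm, intervalIntegral.integral_interval_sub_left (hg _ _) (hg _ _),
      NNReal.coe_one, Real.dist_eq]
    exact intervalIntegral.norm_integral_le_of_norm_le_const fun _ _ => hu _
  · have hstep : ∀ k : ℕ, ∫ s in (k * h)..((k + 1 : ℕ) * h), g s = p (k + 1) - p k := fun k => by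
      rw [integral_comp_floor_div hh u k, smul_inv_smul₀ hh.ne']
    have hsum := intervalIntegral.sum_integral_adjacent_intervals (n := j) fun k _ =>
      hg (k * h) ((k + 1 : ℕ) * h)
    rw [Nat.cast_zero, zero_mul, Finset.sum_congr rfl fun k _ => hstep k,
      Finset.sum_range_sub] at hsum
    exact (congrArg (p 0 + ·) hsum).symm.trans (add_sub_cancel _ _)

end LipschitzPath

section RiemannSum

variable {E : Type*} [NormedAddCommGroup E] [InnerProductSpace ℝ E]

/-- The Riemann sum over the first `N` steps of a sequence of points of the work of the vector
field `φ` along it. It is the discrete counterpart of `⟨[γ], φ⟩`. -/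
def riemannSum (φ : E → E) (N : ℕ) (p : ℕ → E) : ℝ :=
  ∑ j ∈ Finset.range N, inner ℝ (φ (p j)) (p (j + 1) - p j)

variable [FiniteDimensional ℝ E] {K : NNReal} {f : ℝ → E} {φ : E → E}

theorem intervalIntegrable_inner_deriv (hφ : Continuous φ) (hf : LipschitzWith K f) (a b : ℝ) :
    IntervalIntegrable (fun t => inner ℝ (φ (f t)) (deriv f t)) volume a b := by
  have := FiniteDimensional.complete ℝ E
  refine ((hφ.comp hf.continuous).norm.mul_const (K : ℝ)).intervalIntegrable a b |>.mono_fun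
    ((hφ.comp hf.continuous).aestronglyMeasurable.inner (aestronglyMeasurable_deriv _ _)) <|
    Filter.Eventually.of_forall fun t => ?_
  calc ‖inner ℝ (φ (f t)) (deriv f t)‖ ≤ ‖φ (f t)‖ * ‖deriv f t‖ := norm_inner_le_norm _ _
    _ ≤ ‖φ (f t)‖ * K :=
      mul_le_mul_of_nonneg_left (norm_deriv_le_of_lipschitz hf) (norm_nonneg _)
    _ ≤ |‖φ (f t)‖ * K| := le_abs_self _

theorem abs_integral_inner_deriv_sub_le (hφ : Continuous φ) (hf : LipschitzWith K f) {a b e : ℝ}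
    (hab : a ≤ b) (he : ∀ t ∈ Icc a b, ‖φ (f t) - φ (f a)‖ ≤ e) :
    |(∫ t in a..b, inner ℝ (φ (f t)) (deriv f t)) - inner ℝ (φ (f a)) (f b - f a)| ≤
      e * K * (b - a) := by
  have := FiniteDimensional.complete ℝ E
  have hderiv := intervalIntegrable_deriv_of_lipschitzWith hf a b
  have hconst : inner ℝ (φ (f a)) (f b - f a) = ∫ t in a..b, inner ℝ (φ (f a)) (deriv f t) := by
    rw [← integral_deriv_eq_sub_of_lipschitzWith hf]
    exact ((innerSL ℝ (φ (f a))).intervalIntegral_comp_comm hderiv).symm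
  have hint : IntervalIntegrable (fun t => inner ℝ (φ (f a)) (deriv f t)) volume a b :=
    intervalIntegrable_inner_deriv (φ := fun _ => φ (f a)) continuous_const hf a b
  rw [hconst, ← intervalIntegral.integral_sub (intervalIntegrable_inner_deriv hφ hf a b) hint,
    ← Real.norm_eq_abs, ← abs_of_nonneg (sub_nonneg.2 hab)]
  refine intervalIntegral.norm_integral_le_of_norm_le_const fun t ht => ?_
  rw [uIoc_of_le hab] at ht
  rw [← inner_sub_left]
  have hφt := he t (Ioc_subset_Icc_self ht)
  calc ‖inner ℝ (φ (f t) - φ (f a)) (deriv f t)‖ ≤ ‖φ (f t) - φ (f a)‖ * ‖deriv f t‖ :=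
        norm_inner_le_norm _ _
    _ ≤ e * K := mul_le_mul hφt (norm_deriv_le_of_lipschitz hf) (norm_nonneg _)
        ((norm_nonneg _).trans hφt)

theorem abs_integral_inner_deriv_sub_riemannSum_le (hφ : Continuous φ) (hf : LipschitzWith K f)
    {h e : ℝ} (hh : 0 ≤ h) (he : ∀ x y, dist x y ≤ K * h → dist (φ x) (φ y) ≤ e) (N : ℕ) :
    |(∫ t in (0 : ℝ)..N * h, inner ℝ (φ (f t)) (deriv f t)) - riemannSum φ N fun j => f (j * h)| ≤
      N * (e * K * h) := by
  have hsum := intervalIntegral.sum_integral_adjacent_intervals (n := N) fun j _ =>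
    intervalIntegrable_inner_deriv hφ hf (j * h) ((j + 1 : ℕ) * h)
  rw [Nat.cast_zero, zero_mul] at hsum
  rw [← hsum, riemannSum, ← Finset.sum_sub_distrib]
  refine (Finset.abs_sum_le_sum_abs _ _).trans ?_
  refine (Finset.sum_le_card_nsmul _ _ (e * K * h) fun j _ => ?_).trans_eq
    (by rw [Finset.card_range, nsmul_eq_mul])
  have hlen : ((j + 1 : ℕ) : ℝ) * h - j * h = h := by push_cast; ring
  refine (abs_integral_inner_deriv_sub_le hφ hf (by linarith) fun t ht => ?_).trans_eq
    (by rw [hlen])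
  rw [← dist_eq_norm]
  refine he _ _ ((hf.dist_le_mul _ _).trans ?_)
  rw [Real.dist_eq, abs_of_nonneg (by linarith [ht.1])]
  gcongr
  linarith [ht.2]

end RiemannSum

section ArzelaAscoli

variable {X E : Type*} [PseudoEMetricSpace X] [NormedAddCommGroup E] [ProperSpace E]

theorem isCompact_setOf_lipschitzWith_norm_le (K : NNReal) (R : ℝ) :
    IsCompact {f : C(X, E) | LipschitzWith K f ∧ ∀ x, ‖f x‖ ≤ R} := by
  refine ArzelaAscoli.isCompact_of_equicontinuous _ ?_ <|
    (LipschitzWith.uniformEquicontinuous _ K fun f => f.2.1).equicontinuous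
  have himage : ContinuousMap.toFun '' {f : C(X, E) | LipschitzWith K f ∧ ∀ x, ‖f x‖ ≤ R} =
      {f : X → E | LipschitzWith K f} ∩ univ.pi fun _ => Metric.closedBall 0 R := by
    ext f
    simp only [mem_image, mem_ofPred_eq, mem_inter_iff, mem_univ_pi, mem_closedBall_zero_iff]
    exact ⟨fun ⟨_, hg, hgf⟩ => hgf ▸ hg, fun hf => ⟨⟨f, hf.1.continuous⟩, hf, rfl⟩⟩
  rw [himage]
  exact (isCompact_univ_pi fun _ => isCompact_closedBall 0 R).inter_left
    (isClosed_setOfPred_lipschitzWith K)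

end ArzelaAscoli

section Curve

variable {n : ℕ} {ℓ : ℝ}

instance (μ : Charge n) : IsFiniteMeasure μ.variation := μ.isFiniteMeasure_variation

theorem lebesgue_univ : lebesgue ℓ univ = ENNReal.ofReal ℓ := by
  rw [lebesgue, (MeasurableEmbedding.subtype_coe measurableSet_Icc).comap_apply, image_univ,
    Subtype.range_coe, Real.volume_Icc, sub_zero]

instance : IsFiniteMeasure (lebesgue ℓ) := ⟨lebesgue_univ.trans_lt ENNReal.ofReal_lt_top⟩

theorem integral_lebesgue {F : Type*} [NormedAddCommGroup F] [NormedSpace ℝ F] (hℓ : 0 ≤ ℓ)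
    (g : ℝ → F) : ∫ t, g t ∂lebesgue ℓ = ∫ t in (0 : ℝ)..ℓ, g t := by
  rw [lebesgue, integral_subtype_comap measurableSet_Icc, integral_Icc_eq_integral_Ioc,
    intervalIntegral.integral_of_le hℓ]

theorem ae_lebesgue_mem_Ioo : ∀ᵐ t ∂lebesgue ℓ, t.1 ∈ Ioo 0 ℓ := by
  have h : ∀ᵐ t ∂(volume : Measure ℝ).restrict (Icc 0 ℓ), t ∈ Ioo 0 ℓ := by
    rw [← Measure.restrict_congr_set Ioo_ae_eq_Icc]
    exact ae_restrict_mem measurableSet_Ioo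
  rw [← map_comap_subtype_coe measurableSet_Icc] at h
  exact ae_of_ae_map measurable_subtype_coe.aemeasurable h

theorem isOpenPosMeasure_lebesgue (hℓ : 0 < ℓ) : (lebesgue ℓ).IsOpenPosMeasure := by
  refine ⟨fun U hU ⟨t, ht⟩ => ?_⟩
  obtain ⟨V, hV, rfl⟩ := isOpen_induced_iff.1 hU
  have hne : (V ∩ Ioo 0 ℓ).Nonempty :=
    mem_closure_iff.1 (by simpa only [closure_Ioo hℓ.ne] using t.2) V hV ht
  rw [lebesgue, (MeasurableEmbedding.subtype_coe measurableSet_Icc).comap_apply,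
    Subtype.image_preimage_coe, inter_comm]
  exact (((hV.inter isOpen_Ioo).measure_pos volume hne).trans_le <|
    measure_mono (inter_subset_inter_right V Ioo_subset_Icc_self)).ne'

namespace Curve

/-- The extension of a curve to the real line by its end points. It has the same velocity on `(0,ℓ)`
as the extension by `0` of `Curve.velocity` and is Lipschitz on the whole line. -/
def extend (hℓ : 0 ≤ ℓ) (γ : Curve n ℓ) : ℝ → Rn n := IccExtend hℓ γ.1

theorem lipschitzWith_extend (hℓ : 0 ≤ ℓ) (γ : Curve n ℓ) : LipschitzWith 1 (γ.extend hℓ) :=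
  (γ.2.comp (LipschitzWith.projIcc hℓ)).weaken (mul_one 1).le

theorem continuous_extend_apply (hℓ : 0 ≤ ℓ) (t : ℝ) :
    Continuous fun γ : Curve n ℓ => γ.extend hℓ t :=
  (continuous_eval_const (F := C(Icc (0 : ℝ) ℓ, Rn n)) (projIcc 0 ℓ hℓ t)).comp
    continuous_subtype_val

theorem velocity_eq_deriv_extend (hℓ : 0 ≤ ℓ) (γ : Curve n ℓ) {t : Icc (0 : ℝ) ℓ}
    (ht : t.1 ∈ Ioo 0 ℓ) : γ.velocity t = deriv (γ.extend hℓ) t := by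
  refine Filter.EventuallyEq.deriv_eq ?_
  filter_upwards [Icc_mem_nhds ht.1 ht.2] with s hs
  rw [extend, IccExtend_of_mem hℓ _ hs]
  exact Subtype.val_injective.extend_apply _ _ (⟨s, hs⟩ : Icc (0 : ℝ) ℓ)

theorem enorm_velocity_le_one (γ : Curve n ℓ) : ∀ᵐ t ∂lebesgue ℓ, ‖γ.velocity t‖ₑ ≤ 1 := by
  filter_upwards [ae_lebesgue_mem_Ioo] with t ht
  have hℓ : 0 ≤ ℓ := t.2.1.trans t.2.2
  rw [γ.velocity_eq_deriv_extend hℓ ht, ← ofReal_norm]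
  exact ENNReal.ofReal_le_one.2 (norm_deriv_le_of_lipschitz (γ.lipschitzWith_extend hℓ))

theorem withDensity_enorm_velocity_le (γ : Curve n ℓ) :
    (lebesgue ℓ).withDensity (fun t => ‖γ.velocity t‖ₑ) ≤ lebesgue ℓ :=
  (withDensity_mono γ.enorm_velocity_le_one).trans_eq withDensity_one

theorem variation_charge_le_map_withDensity (γ : Curve n ℓ) :
    γ.charge.variation ≤ ((lebesgue ℓ).withDensity fun t => ‖γ.velocity t‖ₑ).map γ.1 :=
  VectorMeasure.variation_map_le.trans_eq <| by
    rw [Measure.variation_withDensityᵥ γ.integrable_velocity]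

theorem variation_charge_le (γ : Curve n ℓ) : γ.charge.variation ≤ (lebesgue ℓ).map γ.1 :=
  γ.variation_charge_le_map_withDensity.trans <|
    Measure.map_mono γ.withDensity_enorm_velocity_le γ.1.continuous.measurable

theorem totalVar_charge_le_length (γ : Curve n ℓ) : γ.charge.totalVar ≤ γ.length := by
  refine (γ.variation_charge_le_map_withDensity univ).trans_eq ?_
  rw [Measure.map_apply γ.1.continuous.measurable MeasurableSet.univ, preimage_univ,
    withDensity_apply _ MeasurableSet.univ, Measure.restrict_univ, length]

theorem length_le (γ : Curve n ℓ) : γ.length ≤ ENNReal.ofReal ℓ := by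
  rw [← lebesgue_univ, ← lintegral_one]
  exact lintegral_mono_ae γ.enorm_velocity_le_one

theorem variation_charge_eq_of_totalVar_eq (γ : Curve n ℓ)
    (h : γ.charge.totalVar = ENNReal.ofReal ℓ) :
    γ.charge.variation = (lebesgue ℓ).map γ.1 := by
  refine Measure.eq_of_le_of_measure_univ_eq γ.variation_charge_le ?_
  rw [Measure.map_apply γ.1.continuous.measurable MeasurableSet.univ, preimage_univ, lebesgue_univ]
  exact h

theorem pairing_charge_eq_integral (γ : Curve n ℓ) {φ : Rn n → Rn n} (hφ : Continuous φ) :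
    γ.charge.pairing φ = ∫ t, inner ℝ (φ (γ.1 t)) (γ.velocity t) ∂lebesgue ℓ := by
  have hint : ((lebesgue ℓ).withDensityᵥ γ.velocity).Integrable (φ ∘ γ.1) := by
    rw [VectorMeasure.Integrable, Measure.variation_withDensityᵥ γ.integrable_velocity]
    exact ((hφ.comp γ.1.continuous).integrable_of_hasCompactSupport
      (HasCompactSupport.of_compactSpace _)).mono_measure γ.withDensity_enorm_velocity_le
  exact (VectorMeasure.integral_map γ.1.continuous.measurable hφ.aestronglyMeasurable hint).trans
    (integral_withDensityᵥ (innerSL ℝ) γ.integrable_velocity hint)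

theorem pairing_charge_eq_intervalIntegral (hℓ : 0 ≤ ℓ) (γ : Curve n ℓ) {φ : Rn n → Rn n}
    (hφ : Continuous φ) :
    γ.charge.pairing φ =
      ∫ t in (0 : ℝ)..ℓ, inner ℝ (φ (γ.extend hℓ t)) (deriv (γ.extend hℓ) t) := by
  rw [γ.pairing_charge_eq_integral hφ, ← integral_lebesgue hℓ]
  refine integral_congr_ae (ae_lebesgue_mem_Ioo.mono fun t ht => ?_)
  simp only [γ.velocity_eq_deriv_extend hℓ ht, extend, IccExtend_val]

theorem abs_pairing_charge_sub_riemannSum_le (hℓ : 0 ≤ ℓ) (γ : Curve n ℓ) {φ : Rn n → Rn n}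
    (hφ : Continuous φ) {N : ℕ} (hN : N ≠ 0) {e : ℝ}
    (he : ∀ x y, dist x y ≤ ℓ / N → dist (φ x) (φ y) ≤ e) :
    |γ.charge.pairing φ - riemannSum φ N fun j => γ.extend hℓ (j * (ℓ / N))| ≤ ℓ * e := by
  have hNℓ : N * (ℓ / N) = ℓ := mul_div_cancel₀ _ (Nat.cast_ne_zero.2 hN)
  have hsum := abs_integral_inner_deriv_sub_riemannSum_le hφ (γ.lipschitzWith_extend hℓ)
    (h := ℓ / N) (by positivity) (by simpa using he) N
  rw [hNℓ, ← γ.pairing_charge_eq_intervalIntegral hℓ hφ] at hsum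
  refine hsum.trans_eq ?_
  rw [NNReal.coe_one, mul_one, mul_left_comm, hNℓ, mul_comm]

theorem continuous_pairing_charge (hℓ : 0 ≤ ℓ) {φ : Rn n → Rn n} (hφ : UniformContinuous φ) :
    Continuous fun γ : Curve n ℓ => γ.charge.pairing φ := by
  refine continuous_of_uniform_approx_of_continuous fun u hu => ?_
  obtain ⟨ε, hε, hu⟩ := Metric.mem_uniformity_dist.1 hu
  obtain ⟨e, he, heε⟩ := exists_pos_mul_lt hε ℓ
  obtain ⟨δ, hδ, hmod⟩ := Metric.uniformContinuous_iff_le.1 hφ e he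
  obtain ⟨N, hN⟩ := exists_nat_gt (ℓ / δ)
  have hN0 : (0 : ℝ) < N := (div_nonneg hℓ hδ.le).trans_lt hN
  have hNδ : ℓ / N ≤ δ := ((div_lt_comm₀ hδ hN0).1 hN).le
  refine ⟨fun γ => riemannSum φ N fun j => γ.extend hℓ (j * (ℓ / N)), ?_, fun γ => hu ?_⟩
  · exact continuous_finsetSum _ fun j _ =>
      (hφ.continuous.comp (continuous_extend_apply hℓ _)).inner
        ((continuous_extend_apply hℓ _).sub (continuous_extend_apply hℓ _))
  · exact (γ.abs_pairing_charge_sub_riemannSum_le hℓ hφ.continuous (Nat.cast_pos.1 hN0).ne'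
      fun x y hxy => hmod (hxy.trans hNδ)).trans_lt heε

theorem abs_pairing_charge_le (γ : Curve n ℓ) {φ : Rn n → Rn n} (hφ : Continuous φ)
    (hs : HasCompactSupport φ) :
    |γ.charge.pairing φ| ≤ ∫ t, ‖φ (γ.1 t)‖ ∂lebesgue ℓ := by
  rw [← integral_map γ.1.continuous.measurable.aemeasurable hφ.norm.aestronglyMeasurable]
  exact (abs_integral_inner_le φ).trans <| integral_mono_measure γ.variation_charge_le
    (Filter.Eventually.of_forall fun _ => norm_nonneg _)
    (hφ.integrable_of_hasCompactSupport hs).norm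

theorem dist_apply_le (γ : Curve n ℓ) (s t : Icc (0 : ℝ) ℓ) : dist (γ.1 s) (γ.1 t) ≤ ℓ := by
  refine (γ.2.dist_le_mul s t).trans ?_
  rw [NNReal.coe_one, one_mul]
  exact (Real.dist_le_of_mem_Icc s.2 t.2).trans_eq (sub_zero ℓ)

theorem isCompact_setOf_norm_le (R : ℝ) : IsCompact {γ : Curve n ℓ | ∀ t, ‖γ.1 t‖ ≤ R} := by
  rw [Subtype.isCompact_iff]
  convert isCompact_setOf_lipschitzWith_norm_le (X := Icc (0 : ℝ) ℓ) (E := Rn n) 1 R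
  ext f
  simp [and_comm]

instance : WeaklyLocallyCompactSpace (Curve n ℓ) := by
  refine ⟨fun γ => ⟨_, isCompact_setOf_norm_le (‖γ.1‖ + 1), ?_⟩⟩
  filter_upwards [Metric.ball_mem_nhds γ one_pos] with γ' hγ' t
  calc ‖γ'.1 t‖ ≤ ‖γ'.1‖ := γ'.1.norm_coe_le_norm t
    _ ≤ ‖γ.1‖ + ‖γ'.1 - γ.1‖ := norm_le_norm_add_norm_sub' _ _
    _ ≤ ‖γ.1‖ + 1 := by gcongr; exact (dist_eq_norm γ'.1 γ.1).symm.trans_le hγ'.le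

theorem hasCompactSupport_pairing_charge {φ : Rn n → Rn n} (hφ : Continuous φ)
    (hs : HasCompactSupport φ) : HasCompactSupport fun γ : Curve n ℓ => γ.charge.pairing φ := by
  obtain ⟨R, hR⟩ := hs.isBounded.subset_closedBall 0
  refine HasCompactSupport.intro (isCompact_setOf_norm_le (R + ℓ)) fun γ hγ => ?_
  have hzero : ∀ t, φ (γ.1 t) = 0 := fun t => by
    by_contra ht
    refine hγ fun s => ?_
    have hγt : ‖γ.1 t‖ ≤ R := mem_closedBall_zero_iff.1 (hR (subset_tsupport φ ht))
    linarith [norm_le_norm_add_norm_sub' (γ.1 s) (γ.1 t), γ.dist_apply_le s t,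
      dist_eq_norm (γ.1 s) (γ.1 t)]
  simpa only [hzero, norm_zero, integral_zero, abs_nonpos_iff] using γ.abs_pairing_charge_le hφ hs

end Curve

end Curve

section DiscretePaths

variable {E : Type*} [NormedAddCommGroup E] {p : ℕ → E} {h : ℝ}

/-- The discrete paths from `x` with steps of length at most `h`. They are the controls in the
discrete control problem whose value function is `value`. -/
def discretePaths (h : ℝ) (x : E) : Set (ℕ → E) :=
  {p | p 0 = x ∧ ∀ j, dist (p j) (p (j + 1)) ≤ h}

theorem const_mem_discretePaths (hh : 0 ≤ h) (x : E) : (fun _ => x) ∈ discretePaths h x :=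
  ⟨rfl, fun _ => (dist_self x).trans_le hh⟩

theorem add_const_mem_discretePaths {x : E} (hp : p ∈ discretePaths h x) (v : E) :
    (fun j => p j + v) ∈ discretePaths h (x + v) :=
  ⟨congrArg (· + v) hp.1, fun j => (dist_add_right _ _ _).trans_le (hp.2 j)⟩

theorem dist_le_of_mem_discretePaths {x : E} (hp : p ∈ discretePaths h x) (j : ℕ) :
    dist x (p j) ≤ j * h := by
  simpa [hp.1] using dist_le_range_sum_of_dist_le (f := p) (d := fun _ => h) j fun _ => hp.2 _

end DiscretePaths

section Value

variable {E : Type*} [NormedAddCommGroup E] [InnerProductSpace ℝ E] {φ ψ : E → E} {p : ℕ → E}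
  {h C e δ : ℝ}

theorem riemannSum_succ' (φ : E → E) (k : ℕ) (p : ℕ → E) :
    riemannSum φ (k + 1) p =
      inner ℝ (φ (p 0)) (p 1 - p 0) + riemannSum φ k fun j => p (j + 1) := by
  rw [riemannSum, Finset.sum_range_succ', add_comm, riemannSum]

theorem riemannSum_sub (φ ψ : E → E) (k : ℕ) (p : ℕ → E) :
    riemannSum φ k p - riemannSum ψ k p = riemannSum (fun x => φ x - ψ x) k p := by
  simp only [riemannSum, inner_sub_left, Finset.sum_sub_distrib]

theorem riemannSum_add_const (φ : E → E) (k : ℕ) (p : ℕ → E) (v : E) :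
    riemannSum φ k (fun j => p j + v) = riemannSum (fun x => φ (x + v)) k p := by
  simp only [riemannSum, add_sub_add_right_eq_sub]

theorem abs_riemannSum_le (hC : ∀ x, ‖φ x‖ ≤ C) (hp : ∀ j, dist (p j) (p (j + 1)) ≤ h) (k : ℕ) :
    |riemannSum φ k p| ≤ k * (C * h) := by
  refine (Finset.abs_sum_le_sum_abs _ _).trans <|
    (Finset.sum_le_card_nsmul _ _ (C * h) fun j _ => ?_).trans_eq (by simp)
  calc |inner ℝ (φ (p j)) (p (j + 1) - p j)| ≤ ‖φ (p j)‖ * ‖p (j + 1) - p j‖ :=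
        abs_real_inner_le_norm _ _
    _ ≤ C * h := mul_le_mul (hC _) (dist_eq_norm' (p j) (p (j + 1)) ▸ hp j) (norm_nonneg _)
        ((norm_nonneg _).trans (hC 0))

/-- The value function of the discrete control problem: the largest Riemann sum of `φ` over the
discrete paths of `k` steps from `x`. -/
def value (φ : E → E) (h : ℝ) (k : ℕ) (x : E) : ℝ :=
  ⨆ p : discretePaths h x, riemannSum φ k p.1

theorem riemannSum_le_value (hC : ∀ x, ‖φ x‖ ≤ C) {x : E} (hp : p ∈ discretePaths h x) (k : ℕ) :
    riemannSum φ k p ≤ value φ h k x := by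
  refine le_ciSup (f := fun p : discretePaths h x => riemannSum φ k p.1)
    ⟨k * (C * h), ?_⟩ ⟨p, hp⟩
  rintro _ ⟨q, rfl⟩
  exact (abs_le.1 (abs_riemannSum_le hC q.2.2 k)).2

theorem value_le (hh : 0 ≤ h) {k : ℕ} {x : E} {S : ℝ}
    (hS : ∀ p ∈ discretePaths h x, riemannSum φ k p ≤ S) : value φ h k x ≤ S :=
  have : Nonempty (discretePaths h x) := ⟨⟨_, const_mem_discretePaths hh x⟩⟩
  ciSup_le fun p => hS p.1 p.2

theorem value_zero (φ : E → E) (h : ℝ) (x : E) : value φ h 0 x = 0 := by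
  simp [value, riemannSum]

-- Bellman's inequality: a path from `x + w` is extended backwards by the step from `x`.
theorem inner_add_value_le (hh : 0 ≤ h) (hC : ∀ x, ‖φ x‖ ≤ C) (k : ℕ) (x : E) {w : E}
    (hw : ‖w‖ ≤ h) : inner ℝ (φ x) w + value φ h k (x + w) ≤ value φ h (k + 1) x := by
  rw [← le_sub_iff_add_le']
  refine value_le hh fun p hp => ?_
  let q : ℕ → E := fun | 0 => x | j + 1 => p j
  have hq : q ∈ discretePaths h x := by
    refine ⟨rfl, fun | 0 => ?_ | j + 1 => hp.2 j⟩
    change dist x (p 0) ≤ h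
    rwa [hp.1, dist_self_add_right]
  have hsum := riemannSum_le_value hC hq (k + 1)
  rw [riemannSum_succ'] at hsum
  change inner ℝ (φ x) (p 0 - x) + riemannSum φ k p ≤ _ at hsum
  rw [hp.1, add_sub_cancel_left] at hsum
  exact le_sub_iff_add_le'.2 hsum

theorem value_le_value_add (hh : 0 ≤ h) (hC : ∀ x, ‖φ x‖ ≤ C)
    (he : ∀ x y, dist x y ≤ δ → dist (φ x) (φ y) ≤ e) (k : ℕ) {x y : E} (hxy : dist x y ≤ δ) :
    value φ h k x ≤ value φ h k y + k * (e * h) := by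
  refine value_le hh fun p hp => ?_
  have hshift : (fun j => p j + (y - x)) ∈ discretePaths h y := by
    simpa using add_const_mem_discretePaths hp (y - x)
  have hφ : ∀ z, ‖φ z - φ (z + (y - x))‖ ≤ e := fun z => by
    rw [← dist_eq_norm]
    exact he _ _ (by rwa [dist_self_add_right, ← dist_eq_norm'])
  have hsum := (abs_le.1 (abs_riemannSum_le hφ hp.2 k)).2
  rw [← riemannSum_sub, ← riemannSum_add_const] at hsum
  linarith [riemannSum_le_value hC hshift k]

theorem dist_value_le (hh : 0 ≤ h) (hC : ∀ x, ‖φ x‖ ≤ C)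
    (he : ∀ x y, dist x y ≤ δ → dist (φ x) (φ y) ≤ e) (k : ℕ) {x y : E} (hxy : dist x y ≤ δ) :
    dist (value φ h k x) (value φ h k y) ≤ k * (e * h) :=
  abs_sub_le_iff.2 ⟨sub_le_iff_le_add'.2 (value_le_value_add hh hC he k hxy),
    sub_le_iff_le_add'.2 (value_le_value_add hh hC he k (dist_comm x y ▸ hxy))⟩

theorem uniformContinuous_value (hh : 0 ≤ h) (hC : ∀ x, ‖φ x‖ ≤ C) (hφ : UniformContinuous φ)
    (k : ℕ) : UniformContinuous (value φ h k) := by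
  refine Metric.uniformContinuous_iff_le.2 fun ε hε => ?_
  obtain ⟨e, he, heε⟩ := exists_pos_mul_lt hε (k * h)
  obtain ⟨δ, hδ, hδe⟩ := Metric.uniformContinuous_iff_le.1 hφ e he
  refine ⟨δ, hδ, fun x y hxy => (dist_value_le hh hC (fun _ _ hxy => hδe hxy) k hxy).trans ?_⟩
  rw [mul_comm e, ← mul_assoc]
  exact heε.le

theorem hasCompactSupport_value [ProperSpace E] (hh : 0 ≤ h) (hs : HasCompactSupport φ) (k : ℕ) :
    HasCompactSupport (value φ h k) := by
  refine HasCompactSupport.intro (hs.isCompact.cthickening (r := k * h)) fun x hx => ?_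
  have hsum : ∀ p ∈ discretePaths h x, riemannSum φ k p = 0 := fun p hp => by
    refine Finset.sum_eq_zero fun j hj => ?_
    have hj : p j ∉ tsupport φ := fun hpj => hx <| Metric.mem_cthickening_of_dist_le _ _ _ _ hpj <|
      (dist_le_of_mem_discretePaths hp j).trans (by gcongr; exact (Finset.mem_range.1 hj).le)
    rw [image_eq_zero_of_notMem_tsupport hj, inner_zero_left]
  have : Nonempty (discretePaths h x) := ⟨⟨_, const_mem_discretePaths hh x⟩⟩
  exact (iSup_congr fun p : discretePaths h x => hsum p.1 p.2).trans ciSup_const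

end Value

section ValueCurve

variable {n : ℕ} {ℓ : ℝ}

theorem Curve.exists_interpolating (hℓ : 0 < ℓ) {N : ℕ} (hN : N ≠ 0) {p : ℕ → Rn n}
    (hp : ∀ j, dist (p j) (p (j + 1)) ≤ ℓ / N) :
    ∃ γ : Curve n ℓ, ∀ j ≤ N, γ.extend hℓ.le (j * (ℓ / N)) = p j := by
  have hh : 0 < ℓ / N := by positivity
  obtain ⟨f, hf, hfp⟩ := exists_lipschitzWith_one_interpolating hh hp
  have hlip : LipschitzWith 1 (fun t : Icc (0 : ℝ) ℓ => f t) :=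
    (hf.comp (LipschitzWith.subtype_val _)).weaken (mul_one 1).le
  refine ⟨⟨⟨_, hlip.continuous⟩, hlip⟩, fun j hj => ?_⟩
  have hmem : j * (ℓ / N) ∈ Icc 0 ℓ := by
    refine ⟨by positivity, ?_⟩
    calc j * (ℓ / N) ≤ N * (ℓ / N) := by gcongr
      _ = ℓ := mul_div_cancel₀ _ (Nat.cast_ne_zero.2 hN)
  rw [Curve.extend, IccExtend_of_mem hℓ.le _ hmem]
  exact hfp j

theorem value_le_of_forall_pairing_charge_le (hℓ : 0 < ℓ) {φ : Rn n → Rn n} (hφ : Continuous φ)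
    {N : ℕ} (hN : N ≠ 0) {e : ℝ} (he : ∀ x y, dist x y ≤ ℓ / N → dist (φ x) (φ y) ≤ e) {S : ℝ}
    (hS : ∀ γ : Curve n ℓ, γ.charge.pairing φ ≤ S) (x : Rn n) :
    value φ (ℓ / N) N x ≤ S + ℓ * e := by
  refine value_le (by positivity) fun p hp => ?_
  obtain ⟨γ, hγ⟩ := Curve.exists_interpolating hℓ hN hp.2
  have hsum : riemannSum φ N (fun j => γ.extend hℓ.le (j * (ℓ / N))) = riemannSum φ N p :=
    Finset.sum_congr rfl fun j hj => by
      simp only [hγ j (Finset.mem_range.1 hj).le, hγ (j + 1) (Finset.mem_range.1 hj)]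
  have happrox := γ.abs_pairing_charge_sub_riemannSum_le hℓ.le hφ hN he
  rw [hsum] at happrox
  linarith [hS γ, (abs_le.1 happrox).1]

end ValueCurve

section Mollification

variable {E : Type*} [NormedAddCommGroup E] [InnerProductSpace ℝ E] [FiniteDimensional ℝ E]
  [MeasurableSpace E] [BorelSpace E] (ρ : ContDiffBump (0 : E)) {u v : E → ℝ} {φ : E → E}
  {h m e : ℝ}

/-- The convolution of a function with a normalized bump function. It turns the value function into
a test function, against which a divergence can be tested. -/
def mollify (u : E → ℝ) : E → ℝ :=
  convolution (ρ.normed volume) u (ContinuousLinearMap.lsmul ℝ ℝ) volume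

theorem mollify_apply (u : E → ℝ) (x : E) :
    mollify ρ u x = ∫ t, ρ.normed volume t * u (x - t) := rfl

theorem integrable_normed_mul {g : E → ℝ} (hg : Continuous g) :
    Integrable fun t => ρ.normed volume t * g t :=
  (ρ.continuous_normed.mul hg).integrable_of_hasCompactSupport ρ.hasCompactSupport_normed.mul_right

theorem contDiff_mollify (hu : Continuous u) : ContDiff ℝ (⊤ : ℕ∞) (mollify ρ u) :=
  ρ.hasCompactSupport_normed.contDiff_convolution_left _ ρ.contDiff_normed hu.locallyIntegrable

theorem hasCompactSupport_mollify (hs : HasCompactSupport u) : HasCompactSupport (mollify ρ u) :=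
  ρ.hasCompactSupport_normed.convolution _ hs

theorem integrable_mollify {η : Measure E} [IsFiniteMeasureOnCompacts η] (hu : Continuous u)
    (hs : HasCompactSupport u) : Integrable (mollify ρ u) η :=
  (contDiff_mollify ρ hu).continuous.integrable_of_hasCompactSupport
    (hasCompactSupport_mollify ρ hs)

theorem le_mollify_sub_mollify (hu : Continuous u) (hv : Continuous v) (x y : E) {c : ℝ}
    (hc : ∀ t, ‖t‖ ≤ ρ.rOut → c ≤ u (x - t) - v (y - t)) :
    c ≤ mollify ρ u x - mollify ρ v y := by
  have hu' := integrable_normed_mul ρ (hu.comp (continuous_const.sub continuous_id) : Continuous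
    fun t => u (x - t))
  have hv' := integrable_normed_mul ρ (hv.comp (continuous_const.sub continuous_id) : Continuous
    fun t => v (y - t))
  calc c = ∫ t, ρ.normed volume t * c := by rw [integral_mul_const, ρ.integral_normed, one_mul]
    _ ≤ ∫ t, (ρ.normed volume t * u (x - t) - ρ.normed volume t * v (y - t)) := by
      refine integral_mono (integrable_normed_mul ρ continuous_const) (hu'.sub hv') fun t => ?_
      by_cases ht : t ∈ Function.support (ρ.normed volume)
      · rw [ρ.support_normed_eq, mem_ball_zero_iff] at ht
        simpa only [mul_sub] using mul_le_mul_of_nonneg_left (hc t ht.le) (ρ.nonneg_normed t)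
      · simp only [Function.notMem_support.1 ht, zero_mul, sub_zero, le_refl]
    _ = mollify ρ u x - mollify ρ v y := integral_sub hu' hv'

theorem mollify_zero (x : E) : mollify ρ (fun _ => 0) x = 0 := by
  simp [mollify_apply]

theorem mollify_le (hu : Continuous u) {C : ℝ} (hC : ∀ x, u x ≤ C) (x : E) :
    mollify ρ u x ≤ C := by
  have := le_mollify_sub_mollify ρ (continuous_const (y := (0 : ℝ))) hu x x (c := -C) fun t _ => by
    linarith [hC (x - t)]
  rw [mollify_zero] at this
  linarith

theorem hasFDerivAt_mollify (hu : Continuous u) (x : E) :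
    HasFDerivAt (mollify ρ u) (∫ t, u (x - t) • fderiv ℝ (ρ.normed volume) t) x := by
  have hderiv := (ρ.hasCompactSupport_normed (μ := volume)).hasFDerivAt_convolution_left
    (μ := volume) (ContinuousLinearMap.lsmul ℝ ℝ) ρ.contDiff_normed hu.locallyIntegrable x
  refine hderiv.congr_fderiv ?_
  rw [convolution_def]
  congr 1 with t y
  simp [ContinuousLinearMap.precompL_apply, mul_comm]

/-- The `L¹` norm of the derivative of a normalized bump function. It bounds the modulus of
continuity of the derivative of a mollification in terms of that of the function. -/
def derivMass : ℝ := ∫ t, ‖fderiv ℝ (ρ.normed volume) t‖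

theorem derivMass_nonneg : 0 ≤ derivMass ρ := integral_nonneg fun _ => norm_nonneg _

theorem norm_fderiv_mollify_sub_le (hu : Continuous u)
    (hm : ∀ x y, dist x y ≤ h → dist (u x) (u y) ≤ m) {x y : E} (hxy : dist x y ≤ h) :
    ‖fderiv ℝ (mollify ρ u) x - fderiv ℝ (mollify ρ u) y‖ ≤ m * derivMass ρ := by
  have hc : Continuous (fderiv ℝ (ρ.normed (volume : Measure E))) :=
    (ρ.contDiff_normed (n := 1)).continuous_fderiv one_ne_zero
  have hcs := (ρ.hasCompactSupport_normed (μ := volume)).fderiv ℝ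
  have hi : ∀ z, Integrable fun t => u (z - t) • fderiv ℝ (ρ.normed volume) t := fun z =>
    ((hu.comp (continuous_const.sub continuous_id)).smul hc).integrable_of_hasCompactSupport
      hcs.smul_left
  rw [(hasFDerivAt_mollify ρ hu x).fderiv, (hasFDerivAt_mollify ρ hu y).fderiv,
    ← integral_sub (hi x) (hi y), derivMass, ← integral_const_mul]
  refine norm_integral_le_of_norm_le
    ((hc.integrable_of_hasCompactSupport hcs).norm.const_mul m)
    (Filter.Eventually.of_forall fun t => ?_)
  rw [← sub_smul, norm_smul, ← dist_eq_norm]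
  exact mul_le_mul_of_nonneg_right (hm _ _ (by rwa [dist_sub_right])) (norm_nonneg _)

theorem abs_mollify_add_sub_sub_fderiv_le (hu : Continuous u)
    (hm : ∀ x y, dist x y ≤ h → dist (u x) (u y) ≤ m) (x : E) {w : E} (hw : ‖w‖ ≤ h) :
    |mollify ρ u (x + w) - mollify ρ u x - fderiv ℝ (mollify ρ u) x w| ≤
      m * derivMass ρ * h := by
  have hd : ∀ z, HasFDerivAt (mollify ρ u) (fderiv ℝ (mollify ρ u) z) z := fun z =>
    (hasFDerivAt_mollify ρ hu z).differentiableAt.hasFDerivAt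
  have hmean := Convex.norm_image_sub_le_of_norm_hasFDerivWithin_le' (f := mollify ρ u) (𝕜 := ℝ)
    (s := Metric.closedBall x h) (x := x) (y := x + w) (C := m * derivMass ρ)
    (φ := fderiv ℝ (mollify ρ u) x) (fun z _ => (hd z).hasFDerivWithinAt)
    (fun z hz => norm_fderiv_mollify_sub_le ρ hu hm hz) (convex_closedBall x h)
    (Metric.mem_closedBall_self ((norm_nonneg w).trans hw)) (by simpa using hw)
  rw [add_sub_cancel_left] at hmean
  have hm0 : 0 ≤ m := dist_nonneg.trans (hm 0 0 (by simpa using (norm_nonneg w).trans hw))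
  exact hmean.trans <|
    mul_le_mul_of_nonneg_left hw (mul_nonneg hm0 (derivMass_nonneg ρ))

theorem continuous_gradient_mollify (hu : Continuous u) : Continuous (∇ (mollify ρ u)) :=
  (InnerProductSpace.toDual ℝ E).symm.continuous.comp
    ((contDiff_mollify ρ hu).continuous_fderiv (by simp))

theorem hasCompactSupport_gradient_mollify (hs : HasCompactSupport u) :
    HasCompactSupport (∇ (mollify ρ u)) :=
  ((hasCompactSupport_mollify ρ hs).fderiv ℝ).comp_left
    (g := (InnerProductSpace.toDual ℝ E).symm) (map_zero _)

theorem inner_sub_le_mollify_sub_mollify (hu : Continuous u) (hv : Continuous v)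
    (he : ∀ x y, dist x y ≤ ρ.rOut → dist (φ x) (φ y) ≤ e) {w : E}
    (hstep : ∀ x, inner ℝ (φ x) w + v (x + w) ≤ u x) (x : E) :
    inner ℝ (φ x) w - e * ‖w‖ ≤ mollify ρ u x - mollify ρ v (x + w) := by
  refine le_mollify_sub_mollify ρ hu hv _ _ fun t ht => ?_
  have hinner : inner ℝ (φ x - φ (x - t)) w ≤ e * ‖w‖ := by
    refine (real_inner_le_norm _ _).trans (mul_le_mul_of_nonneg_right ?_ (norm_nonneg w))
    rw [← dist_eq_norm]
    exact he _ _ (by rwa [dist_self_sub_right])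
  rw [inner_sub_left] at hinner
  rw [← sub_add_eq_add_sub]
  linarith [hstep (x - t)]

-- Equality in Cauchy–Schwarz: the step `w` of length `h` points in the direction of `φ x + ∇ V x`.
theorem mul_norm_add_gradient_mollify_le (hu : Continuous u) (hv : Continuous v) (hh : 0 ≤ h)
    (he : ∀ x y, dist x y ≤ ρ.rOut → dist (φ x) (φ y) ≤ e)
    (hm : ∀ x y, dist x y ≤ h → dist (v x) (v y) ≤ m)
    (hstep : ∀ x w, ‖w‖ ≤ h → inner ℝ (φ x) w + v (x + w) ≤ u x) (x : E) :
    h * ‖φ x + ∇ (mollify ρ v) x‖ ≤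
      mollify ρ u x - mollify ρ v x + h * (e + m * derivMass ρ) := by
  set z := φ x + ∇ (mollify ρ v) x with hz
  set w := h • NormedSpace.normalize z
  have hw : ‖w‖ ≤ h := by
    rw [norm_smul, Real.norm_of_nonneg hh]
    exact mul_le_of_le_one_right hh (norm_normalize_le_one z)
  have hzw : inner ℝ (φ x) w + fderiv ℝ (mollify ρ v) x w = h * ‖z‖ := by
    rw [← inner_gradient_left, ← inner_add_left, ← hz, real_inner_smul_right, real_inner_comm,
      inner_normalize_self]
  have he0 : 0 ≤ e := dist_nonneg.trans (he 0 0 (by simpa using ρ.rOut_pos.le))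
  have hincr := inner_sub_le_mollify_sub_mollify ρ hu hv he (fun y => hstep y w hw) x
  have hlin := (abs_le.1 (abs_mollify_add_sub_sub_fderiv_le ρ hv hm x hw)).1
  linarith [mul_le_mul_of_nonneg_left hw he0]

end Mollification

section KeyInequality

variable {n : ℕ} {ℓ h m e : ℝ} {μ : Charge n} {φ : Rn n → Rn n}

theorem Charge.pairing_gradient_mollify (hμ : μ.div = 0) (ρ : ContDiffBump (0 : Rn n))
    {u : Rn n → ℝ} (hu : Continuous u) (hs : HasCompactSupport u) :
    μ.pairing (∇ (mollify ρ u)) = 0 := by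
  have := congrFun hμ ⟨mollify ρ u, contDiff_mollify ρ hu, hasCompactSupport_mollify ρ hs, by simp⟩
  simpa [Charge.div] using this

theorem Charge.mul_pairing_sub_le_integral_mollify_sub (hμ : μ.div = 0) (hφ : Continuous φ)
    (hφs : HasCompactSupport φ) (ρ : ContDiffBump (0 : Rn n)) {u v : Rn n → ℝ} (hu : Continuous u)
    (hus : HasCompactSupport u) (hv : Continuous v) (hvs : HasCompactSupport v) (hh : 0 ≤ h)
    (he : ∀ x y, dist x y ≤ ρ.rOut → dist (φ x) (φ y) ≤ e)
    (hm : ∀ x y, dist x y ≤ h → dist (v x) (v y) ≤ m)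
    (hstep : ∀ x w, ‖w‖ ≤ h → inner ℝ (φ x) w + v (x + w) ≤ u x) :
    h * (μ.pairing φ - (e + m * derivMass ρ) * μ.variation.real univ) ≤
      ∫ x, mollify ρ u x ∂μ.variation - ∫ x, mollify ρ v x ∂μ.variation := by
  have hUi : Integrable (mollify ρ u) μ.variation := integrable_mollify ρ hu hus
  have hVi : Integrable (mollify ρ v) μ.variation := integrable_mollify ρ hv hvs
  have hUVi : Integrable (fun x => mollify ρ u x - mollify ρ v x) μ.variation := hUi.sub hVi
  have hφi : μ.Integrable φ := hφ.integrable_of_hasCompactSupport hφs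
  have hGi : μ.Integrable (∇ (mollify ρ v)) :=
    (continuous_gradient_mollify ρ hv).integrable_of_hasCompactSupport
      (hasCompactSupport_gradient_mollify ρ hvs)
  have hadd : μ.pairing φ = μ.pairing (φ + ∇ (mollify ρ v)) := by
    rw [← add_zero (μ.pairing φ), ← Charge.pairing_gradient_mollify hμ ρ hv hvs]
    exact (VectorMeasure.integral_add hφi hGi).symm
  have hbound := calc
    h * μ.pairing φ ≤ h * ∫ x, ‖φ x + ∇ (mollify ρ v) x‖ ∂μ.variation := by
      rw [hadd]
      exact mul_le_mul_of_nonneg_left ((le_abs_self _).trans (abs_integral_inner_le _)) hh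
    _ = ∫ x, h * ‖φ x + ∇ (mollify ρ v) x‖ ∂μ.variation := (integral_const_mul _ _).symm
    _ ≤ ∫ x, (mollify ρ u x - mollify ρ v x + h * (e + m * derivMass ρ)) ∂μ.variation :=
      integral_mono ((hφi.add hGi).norm.const_mul h) (hUVi.add (integrable_const _))
        (mul_norm_add_gradient_mollify_le ρ hu hv hh he hm hstep)
  rw [integral_add hUVi (integrable_const _), integral_sub hUi hVi, integral_const,
    smul_eq_mul] at hbound
  linarith

-- Telescoping the one-step inequality from `value φ h 0 = 0` to `value φ h N`, with `h = ℓ / N`.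
theorem Charge.mul_pairing_le_add_error (hℓ : 0 < ℓ) (hμ : μ.div = 0) (hφ : Continuous φ)
    (hs : HasCompactSupport φ) {S : ℝ} (hS : ∀ γ : Curve n ℓ, γ.charge.pairing φ ≤ S)
    (ρ : ContDiffBump (0 : Rn n)) (he : ∀ x y, dist x y ≤ ρ.rOut → dist (φ x) (φ y) ≤ e)
    {N : ℕ} (hN : N ≠ 0) (hm : ∀ x y, dist x y ≤ ℓ / N → dist (φ x) (φ y) ≤ m) :
    ℓ * μ.pairing φ ≤ μ.variation.real univ * S +
      ℓ * μ.variation.real univ * (e + (1 + ℓ * derivMass ρ) * m) := by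
  obtain ⟨C, hC⟩ := hs.exists_bound_of_continuous hφ
  set h := ℓ / N
  have hh : 0 ≤ h := by positivity
  have hNh : N * h = ℓ := mul_div_cancel₀ _ (Nat.cast_ne_zero.2 hN)
  have hm0 : 0 ≤ m := dist_nonneg.trans (hm 0 0 (by simpa using hh))
  have hcont : ∀ k, Continuous (value φ h k) := fun k =>
    (uniformContinuous_value hh hC (hs.uniformContinuous_of_continuous hφ) k).continuous
  have hcs : ∀ k, HasCompactSupport (value φ h k) := hasCompactSupport_value hh hs
  let A : ℕ → ℝ := fun k => ∫ x, mollify ρ (value φ h k) x ∂μ.variation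
  have hstep : ∀ k ∈ Finset.range N, h * (μ.pairing φ -
      (e + ℓ * m * derivMass ρ) * μ.variation.real univ) ≤ A (k + 1) - A k := by
    intro k hk
    refine Charge.mul_pairing_sub_le_integral_mollify_sub hμ hφ hs ρ (hcont _) (hcs _) (hcont _)
      (hcs _) hh he (fun x y hxy => (dist_value_le hh hC hm k hxy).trans ?_)
      fun x w hw => inner_add_value_le hh hC k x hw
    calc k * (m * h) ≤ N * (m * h) := by gcongr; exact (Finset.mem_range.1 hk).le
      _ = ℓ * m := by rw [← hNh]; ring
  have hsum := Finset.sum_le_sum hstep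
  rw [Finset.sum_range_sub, Finset.sum_const, Finset.card_range, nsmul_eq_mul, ← mul_assoc,
    hNh] at hsum
  have hzero : A 0 = 0 := by simp [A, funext (value_zero φ h), mollify_zero]
  have hlast : A N ≤ μ.variation.real univ * (S + ℓ * m) := by
    refine (integral_mono (integrable_mollify ρ (hcont N) (hcs N)) (integrable_const _)
      (mollify_le ρ (hcont N) (value_le_of_forall_pairing_charge_le hℓ hφ hN hm hS))).trans_eq ?_
    rw [integral_const, smul_eq_mul]
  linarith

theorem Charge.mul_pairing_le (hℓ : 0 < ℓ) (hμ : μ.div = 0) (hφ : Continuous φ)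
    (hs : HasCompactSupport φ) {S : ℝ} (hS : ∀ γ : Curve n ℓ, γ.charge.pairing φ ≤ S) :
    ℓ * μ.pairing φ ≤ μ.variation.real univ * S := by
  have hφu := Metric.uniformContinuous_iff_le.1 (hs.uniformContinuous_of_continuous hφ)
  refine le_of_forall_pos_le_add fun ε hε => ?_
  obtain ⟨e, he, heε⟩ := exists_pos_mul_lt hε (ℓ * μ.variation.real univ * 2)
  obtain ⟨r, hr, hre⟩ := hφu e he
  let ρ : ContDiffBump (0 : Rn n) := ⟨r / 2, r, half_pos hr, half_lt_self hr⟩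
  obtain ⟨m, hm, hme⟩ := exists_pos_mul_lt he (1 + ℓ * derivMass ρ)
  obtain ⟨δ, hδ, hδm⟩ := hφu m hm
  obtain ⟨N, hN⟩ := exists_nat_gt (ℓ / δ)
  have hN0 : (0 : ℝ) < N := (div_pos hℓ hδ).trans hN
  have hNδ : ℓ / N ≤ δ := ((div_lt_comm₀ hδ hN0).1 hN).le
  refine (Charge.mul_pairing_le_add_error hℓ hμ hφ hs hS ρ (fun _ _ hxy => hre hxy)
    (Nat.cast_pos.1 hN0).ne' fun _ _ hxy => hδm (hxy.trans hNδ)).trans ?_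
  gcongr
  calc ℓ * μ.variation.real univ * (e + (1 + ℓ * derivMass ρ) * m)
      ≤ ℓ * μ.variation.real univ * (e + e) := by gcongr
    _ = ℓ * μ.variation.real univ * 2 * e := by ring
    _ ≤ ε := heε.le

end KeyInequality

section Representation

open CompactlySupported

variable {X V : Type*} [TopologicalSpace X] [AddCommGroup V] [Module ℝ V]

theorem exists_linearMap_apply_eq_of_le_sublinear {W : Type*} [AddCommGroup W] [Module ℝ W]
    (F : V →ₗ[ℝ] W) (L : V →ₗ[ℝ] ℝ) (p : W → ℝ) (hsmul : ∀ c : ℝ, 0 < c → ∀ x, p (c • x) = c * p x)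
    (hadd : ∀ x y, p (x + y) ≤ p x + p y) (hL : ∀ v, L v ≤ p (F v)) :
    ∃ g : W →ₗ[ℝ] ℝ, (∀ v, g (F v) = L v) ∧ ∀ x, g x ≤ p x := by
  have hp0 : p 0 = 0 := by
    have := hsmul 2 two_pos 0
    rw [smul_zero] at this
    linarith
  have hker : L ∈ (LinearMap.ker F).dualAnnihilator := by
    refine (Submodule.mem_dualAnnihilator L).2 fun v hv => ?_
    have hpos := hL v
    have hneg := hL (-v)
    rw [map_neg, map_neg, LinearMap.mem_ker.1 hv, neg_zero, hp0] at hneg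
    rw [LinearMap.mem_ker.1 hv, hp0] at hpos
    linarith
  rw [← LinearMap.range_dualMap_eq_dualAnnihilator_ker] at hker
  obtain ⟨g₀, rfl⟩ := hker
  obtain ⟨g, hg, hgp⟩ := exists_extension_of_le_sublinear
    ⟨LinearMap.range F, g₀.domRestrict (LinearMap.range F)⟩ p hsmul hadd
    (by rintro ⟨_, v, rfl⟩; exact hL v)
  exact ⟨g, fun v => hg ⟨F v, v, rfl⟩, hgp⟩

theorem bddAbove_range_max_zero (f : C_c(X, ℝ)) : BddAbove (range fun x => max (f x) 0) := by
  obtain ⟨C, hC⟩ := f.hasCompactSupport.exists_bound_of_continuous f.continuous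
  refine ⟨max C 0, ?_⟩
  rintro _ ⟨x, rfl⟩
  exact max_le_max_right _ ((le_abs_self _).trans (hC x))

theorem iSup_max_zero_smul {r : ℝ} (hr : 0 ≤ r) (f : C_c(X, ℝ)) :
    ⨆ x, max ((r • f) x) 0 = r * ⨆ x, max (f x) 0 := by
  rw [Real.mul_iSup_of_nonneg hr]
  simp only [mul_max_of_nonneg _ _ hr, mul_zero, CompactlySupportedContinuousMap.smul_apply,
    smul_eq_mul]

theorem iSup_max_zero_add_le (f g : C_c(X, ℝ)) :
    ⨆ x, max ((f + g) x) 0 ≤ (⨆ x, max (f x) 0) + ⨆ x, max (g x) 0 := by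
  refine Real.iSup_le (fun x => ?_) (add_nonneg (Real.iSup_nonneg fun _ => le_max_right _ _)
    (Real.iSup_nonneg fun _ => le_max_right _ _))
  calc max (f x + g x) 0 ≤ max (f x) 0 + max (g x) 0 :=
        max_le (add_le_add (le_max_left _ _) (le_max_left _ _))
          (add_nonneg (le_max_right _ _) (le_max_right _ _))
    _ ≤ _ := add_le_add (le_ciSup (bddAbove_range_max_zero f) x)
          (le_ciSup (bddAbove_range_max_zero g) x)

variable [T2Space X] [LocallyCompactSpace X] [SigmaCompactSpace X] [MeasurableSpace X]
  [BorelSpace X] {c : ℝ}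

theorem exists_measure_integral_eq_of_le_iSup (hc : 0 ≤ c) (g : C_c(X, ℝ) →ₗ[ℝ] ℝ)
    (hg : ∀ f, g f ≤ c * ⨆ x, max (f x) 0) :
    ∃ ν : Measure X, ν univ ≤ ENNReal.ofReal c ∧ ∀ f : C_c(X, ℝ), g f = ∫ x, f x ∂ν := by
  have hpos : ∀ f : C_c(X, ℝ), 0 ≤ f → 0 ≤ g f := by
    intro f hf
    have hneg : ∀ x, max ((-f) x) 0 = 0 := fun x => max_eq_right (neg_nonpos.2 (hf x))
    have hgf := hg (-f)
    simp only [hneg, Real.iSup_const_zero, mul_zero, map_neg] at hgf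
    linarith
  let Λ : C_c(X, ℝ) →ₚ[ℝ] ℝ := PositiveLinearMap.mk₀ g hpos
  refine ⟨RealRMK.rieszMeasure Λ, ?_, fun f => (RealRMK.integral_rieszMeasure Λ f).symm⟩
  have hmono : Monotone (compactCovering X) := compactCovering_subset X
  rw [← iUnion_compactCovering X, hmono.measure_iUnion]
  refine iSup_le fun k => ?_
  obtain ⟨f, hf1, -, hfs, hf01⟩ := exists_continuous_one_zero_of_isCompact
    (isCompact_compactCovering X k) isClosed_empty (disjoint_empty _)
  refine (RealRMK.rieszMeasure_le_of_eq_one Λ (f := ⟨f, hfs⟩) (fun x => (hf01 x).1)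
    (isCompact_compactCovering X k) fun x hx => hf1 hx).trans (ENNReal.ofReal_le_ofReal ?_)
  exact (hg _).trans <| mul_le_of_le_one_right hc <|
    Real.iSup_le (fun x => max_le (hf01 x).2 zero_le_one) zero_le_one

theorem exists_measure_integral_apply_eq_of_le_iSup (hc : 0 ≤ c) (F : V →ₗ[ℝ] C_c(X, ℝ))
    (L : V →ₗ[ℝ] ℝ) (hL : ∀ v, L v ≤ c * ⨆ x, max (F v x) 0) :
    ∃ ν : Measure X, ν univ ≤ ENNReal.ofReal c ∧ ∀ v, L v = ∫ x, F v x ∂ν := by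
  obtain ⟨g, hgF, hg⟩ := exists_linearMap_apply_eq_of_le_sublinear F L
    (fun f => c * ⨆ x, max (f x) 0)
    (fun r hr f => by rw [iSup_max_zero_smul hr.le, mul_left_comm])
    (fun f g => by
      rw [← mul_add]
      exact mul_le_mul_of_nonneg_left (iSup_max_zero_add_le f g) hc) hL
  obtain ⟨ν, hν, hint⟩ := exists_measure_integral_eq_of_le_iSup hc g hg
  exact ⟨ν, hν, fun v => (hgF v).symm.trans (hint (F v))⟩

end Representation

section Decomposition

open CompactlySupported

variable {n : ℕ} {ℓ : ℝ} {μ : Charge n} {ν : Measure (Curve n ℓ)}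

/-- The action of a charge as a linear functional on the continuous fields with compact support. -/
def Charge.pairingFunctional (μ : Charge n) : C_c(Rn n, Rn n) →ₗ[ℝ] ℝ where
  toFun φ := μ.pairing φ
  map_add' φ ψ := VectorMeasure.integral_add
    (φ.continuous.integrable_of_hasCompactSupport φ.hasCompactSupport)
    (ψ.continuous.integrable_of_hasCompactSupport ψ.hasCompactSupport)
  map_smul' c φ := VectorMeasure.integral_smul φ μ (innerSL ℝ) c

/-- The map sending a field `φ` to the function `γ ↦ ⟨[γ], φ⟩` on the space of curves. -/
def Curve.pairingMap (hℓ : 0 ≤ ℓ) : C_c(Rn n, Rn n) →ₗ[ℝ] C_c(Curve n ℓ, ℝ) where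
  toFun φ := ⟨⟨fun γ => γ.charge.pairing φ, Curve.continuous_pairing_charge hℓ
      (φ.hasCompactSupport.uniformContinuous_of_continuous φ.continuous)⟩,
    Curve.hasCompactSupport_pairing_charge φ.continuous φ.hasCompactSupport⟩
  map_add' φ ψ := by
    ext γ
    exact map_add γ.charge.pairingFunctional φ ψ
  map_smul' c φ := by
    ext γ
    exact map_smul γ.charge.pairingFunctional c φ

theorem Charge.exists_isDecomposition (hℓ : 0 < ℓ) (hμ : μ.div = 0) :
    ∃ ν : Measure (Curve n ℓ), IsFiniteMeasure ν ∧ IsDecomposition μ ν ∧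
      ENNReal.ofReal ℓ * ν univ ≤ μ.totalVar := by
  have hle : ∀ φ : C_c(Rn n, Rn n), μ.pairingFunctional φ ≤
      μ.variation.real univ / ℓ * ⨆ γ, max (Curve.pairingMap hℓ.le φ γ) 0 := by
    intro φ
    rw [div_mul_eq_mul_div, le_div_iff₀' hℓ]
    exact Charge.mul_pairing_le hℓ hμ φ.continuous φ.hasCompactSupport fun γ =>
      (le_max_left _ _).trans (le_ciSup (bddAbove_range_max_zero (Curve.pairingMap hℓ.le φ)) γ)
  obtain ⟨ν, hν, hint⟩ := exists_measure_integral_apply_eq_of_le_iSup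
    (div_nonneg measureReal_nonneg hℓ.le) (Curve.pairingMap hℓ.le) μ.pairingFunctional hle
  have hfin : IsFiniteMeasure ν := ⟨hν.trans_lt ENNReal.ofReal_lt_top⟩
  refine ⟨ν, hfin, fun φ hφ hs => ⟨?_, hint ⟨⟨φ, hφ⟩, hs⟩⟩, ?_⟩
  · exact (Curve.pairingMap hℓ.le ⟨⟨φ, hφ⟩, hs⟩).continuous.integrable_of_hasCompactSupport
      (Curve.pairingMap hℓ.le ⟨⟨φ, hφ⟩, hs⟩).hasCompactSupport
  · calc ENNReal.ofReal ℓ * ν univ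
        ≤ ENNReal.ofReal ℓ * ENNReal.ofReal (μ.variation.real univ / ℓ) := by gcongr
      _ = μ.totalVar := by
        rw [← ENNReal.ofReal_mul hℓ.le, mul_div_cancel₀ _ hℓ.ne', ofReal_measureReal,
          Charge.totalVar]

theorem Curve.measurable_eval : Measurable fun p : Curve n ℓ × Icc (0 : ℝ) ℓ => p.1.1 p.2 :=
  ((continuous_subtype_val.comp continuous_fst).eval continuous_snd).measurable

theorem Curve.measurable_lebesgue_preimage {A : Set (Rn n)} (hA : MeasurableSet A) :
    Measurable fun γ : Curve n ℓ => lebesgue ℓ (γ.1 ⁻¹' A) :=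
  measurable_measure_prodMk_left (Curve.measurable_eval hA)

namespace IsDecomposition

theorem totalVar_le_lintegral (hdec : IsDecomposition μ ν) :
    μ.totalVar ≤ ∫⁻ γ, γ.charge.totalVar ∂ν := by
  refine le_of_forall_lt fun c hc => ?_
  obtain ⟨φ, hφ, hs, hφ1, hcφ⟩ := exists_continuous_integral_inner_gt hc
  have hγ : ∀ γ : Curve n ℓ, ‖γ.charge.pairing φ‖ₑ ≤ γ.charge.totalVar := fun γ => by
    rw [← ofReal_norm, Charge.totalVar, ← ofReal_measureReal]
    refine ENNReal.ofReal_le_ofReal ((abs_integral_inner_le φ).trans ?_)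
    refine (integral_mono (hφ.integrable_of_hasCompactSupport hs).norm (integrable_const 1)
      hφ1).trans_eq ?_
    rw [integral_const, smul_eq_mul, mul_one]
  calc c < ENNReal.ofReal (μ.pairing φ) := (ENNReal.lt_ofReal_iff_toReal_lt hc.ne_top).2 hcφ
    _ ≤ ‖∫ γ : Curve n ℓ, γ.charge.pairing φ ∂ν‖ₑ :=
      (hdec φ hφ hs).2 ▸ Real.ofReal_le_enorm _
    _ ≤ ∫⁻ γ, γ.charge.totalVar ∂ν :=
      (enorm_integral_le_lintegral_enorm _).trans (lintegral_mono hγ)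

theorem ae_totalVar_charge_eq [IsFiniteMeasure ν] (hdec : IsDecomposition μ ν)
    (hmass : ENNReal.ofReal ℓ * ν univ ≤ μ.totalVar) :
    ∀ᵐ γ ∂ν, γ.charge.totalVar = ENNReal.ofReal ℓ := by
  have hle : ∀ γ : Curve n ℓ, γ.charge.totalVar ≤ ENNReal.ofReal ℓ := fun γ =>
    γ.totalVar_charge_le_length.trans γ.length_le
  refine ae_eq_of_ae_le_of_lintegral_le (Filter.Eventually.of_forall hle) ?_ aemeasurable_const ?_
  · refine ((lintegral_mono hle).trans_lt ?_).ne
    rw [lintegral_const]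
    exact ENNReal.mul_lt_top ENNReal.ofReal_lt_top (measure_lt_top _ _)
  · rw [lintegral_const]
    exact hmass.trans hdec.totalVar_le_lintegral

theorem variation_le_map_eval [IsFiniteMeasure ν] (hdec : IsDecomposition μ ν) :
    μ.variation ≤ (ν.prod (lebesgue ℓ)).map fun p => p.1.1 p.2 := by
  refine variation_le_of_abs_integral_inner_le fun φ hφ hs => ?_
  obtain ⟨C, hC⟩ := hs.exists_bound_of_continuous hφ
  have hi : Integrable (fun p : Curve n ℓ × Icc (0 : ℝ) ℓ => ‖φ (p.1.1 p.2)‖)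
      (ν.prod (lebesgue ℓ)) :=
    Integrable.of_bound (hφ.norm.measurable.comp Curve.measurable_eval).aestronglyMeasurable C
      (Filter.Eventually.of_forall fun p => (norm_norm _).trans_le (hC _))
  rw [integral_map Curve.measurable_eval.aemeasurable hφ.norm.aestronglyMeasurable,
    integral_prod _ hi]
  refine (congrArg abs (hdec φ hφ hs).2).trans_le ?_
  refine MeasureTheory.norm_integral_le_of_norm_le
    (f := fun γ : Curve n ℓ => γ.charge.pairing φ) hi.integral_prod_left
    (Filter.Eventually.of_forall fun γ => ?_)
  exact γ.abs_pairing_charge_le hφ hs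

theorem variation_eq_map_eval [IsFiniteMeasure ν] (hdec : IsDecomposition μ ν)
    (hmass : ENNReal.ofReal ℓ * ν univ ≤ μ.totalVar) :
    μ.variation = (ν.prod (lebesgue ℓ)).map fun p => p.1.1 p.2 := by
  refine Measure.eq_of_le_of_measure_univ_eq hdec.variation_le_map_eval
    (le_antisymm (hdec.variation_le_map_eval univ) ?_)
  rw [Measure.map_apply Curve.measurable_eval MeasurableSet.univ, preimage_univ, ← univ_prod_univ,
    Measure.prod_prod, lebesgue_univ, mul_comm]
  exact hmass

theorem variation_apply [IsFiniteMeasure ν] (hdec : IsDecomposition μ ν)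
    (hmass : ENNReal.ofReal ℓ * ν univ ≤ μ.totalVar) {A : Set (Rn n)} (hA : MeasurableSet A) :
    μ.variation A = ∫⁻ γ, lebesgue ℓ (γ.1 ⁻¹' A) ∂ν := by
  rw [hdec.variation_eq_map_eval hmass, Measure.map_apply Curve.measurable_eval hA,
    Measure.prod_apply (Curve.measurable_eval hA)]
  rfl

theorem variationDecomposes [IsFiniteMeasure ν] (hdec : IsDecomposition μ ν)
    (hmass : ENNReal.ofReal ℓ * ν univ ≤ μ.totalVar) : VariationDecomposes μ ν := by
  intro A hA
  have hvar : ∀ᵐ γ ∂ν, lebesgue ℓ (γ.1 ⁻¹' A) = γ.charge.variation A := by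
    filter_upwards [hdec.ae_totalVar_charge_eq hmass] with γ hγ
    rw [γ.variation_charge_eq_of_totalVar_eq hγ, Measure.map_apply γ.1.continuous.measurable hA]
  exact ⟨(Curve.measurable_lebesgue_preimage hA).aemeasurable.congr hvar,
    (hdec.variation_apply hmass hA).trans (lintegral_congr_ae hvar)⟩

theorem ae_forall_mem_supp [IsFiniteMeasure ν] (hℓ : 0 < ℓ) (hdec : IsDecomposition μ ν)
    (hmass : ENNReal.ofReal ℓ * ν univ ≤ μ.totalVar) : ∀ᵐ γ ∂ν, ∀ t, γ.1 t ∈ μ.supp := by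
  have hclosed : IsClosed μ.supp := Measure.isClosed_support
  have hnull : ∀ᵐ γ : Curve n ℓ ∂ν, lebesgue ℓ (γ.1 ⁻¹' μ.suppᶜ) = 0 := by
    refine (lintegral_eq_zero_iff
      (Curve.measurable_lebesgue_preimage hclosed.measurableSet.compl)).1 ?_
    rw [← hdec.variation_apply hmass hclosed.measurableSet.compl]
    exact Measure.measure_compl_support
  filter_upwards [hnull] with γ hγ t
  have := isOpenPosMeasure_lebesgue hℓ
  by_contra ht
  exact ((hclosed.isOpen_compl.preimage γ.1.continuous).measure_pos (lebesgue ℓ) ⟨t, ht⟩).ne' hγ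

end IsDecomposition

end Decomposition

end Smirnov

end

theorem theorem1 (n : ℕ) (ℓ : ℝ) (hℓ : 0 < ℓ) (μ : Smirnov.Charge n) (hμ : μ.div = 0) :
    ∃ ν : Measure (Smirnov.Curve n ℓ), IsFiniteMeasure ν ∧
      Smirnov.IsDecomposition μ ν ∧
      Smirnov.VariationDecomposes μ ν ∧
      ∀ᵐ γ ∂ν, (∀ t, γ.1 t ∈ μ.supp) ∧
        γ.charge.totalVar = γ.length ∧ γ.length = ENNReal.ofReal ℓ := by
  obtain ⟨ν, hfin, hdec, hmass⟩ := Smirnov.Charge.exists_isDecomposition hℓ hμ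
  refine ⟨ν, hfin, hdec, hdec.variationDecomposes hmass, ?_⟩
  filter_upwards [hdec.ae_totalVar_charge_eq hmass, hdec.ae_forall_mem_supp hℓ hmass]
    with γ hvar hsupp
  have hlen : γ.length = ENNReal.ofReal ℓ :=
    le_antisymm γ.length_le (hvar ▸ γ.totalVar_charge_le_length)
  exact ⟨hsupp, hvar.trans hlen.symm, hlen⟩
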